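/- **Model.** A downlink has $N\ge 1$ users and $M$ channels and operates in slots $t=0,1,2,\dots$. In slot $t$, $A_i(t)\in\mathbb N$ packets arrive for user $i$, the channel states are $X_{ij}(t)\in\mathcal X\subseteq\mathbb N$, and the scheduler sees an estimate $\mathbf S(t)=(S_{ij}(t))$ with entries in a countable set. The triples $(\mathbf A(t),\mathbf X(t),\mathbf S(t))$ are i.i.d. over the slots and independent of the initial queue lengths $\mathbf Q(0)$ (within a slot any dependence is allowed), with $\mathbb E[A_i^2]<\infty$ and $\mathbb E[X_{ij}^2]<\infty$. Let $\lambda_i=\mathbb E[A_i]$. If user $I_j(t)$ is scheduled on channel $j$ at rate $R_j(t)$, then $$Q_i(t+1)=(Q_i(t)-\mu_i(t))^++A_i(t),\qquad \mu_i(t)=\sum_{j=1}^M \mathbf 1(I_j(t)=i)\,R_j(t)\,\mathbf 1(R_j(t)\le X_{ij}(t)).$$ Let $r^*_{ij}(\mathbf s)$ be the (smallest) maximizer over $x\in\mathcal X$ of $x\,\mathbb P(X_{ij}\ge x\mid\mathbf S=\mathbf s)$, and $v_{ij}(\mathbf s)$ the maximum. The *MaxWeight* policy schedules on channel $j$, when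 $\mathbf S(t)=\mathbf s$, the user $i$ (of smallest index) that maximizes $Q_i(t)\,v_{ij}(\mathbf s)$, at rate $r^*_{ij}(\mathbf s)$. The Markov chain $\mathbf Q(t)$ under MaxWeight is assumed irreducible on its state space. Let $$\mu=\min_{1\le i\le N}\ \sum_{\mathbf s}\mathbb P(\mathbf S=\mathbf s)\sum_{j=1}^M v_{ij}(\mathbf s).$$ Let $\Lambda$ be the network stability region: the closure of the set of arrival rate vectors for which some (possibly randomized) stationary policy, deciding on the basis of $(\mathbf Q(t),\mathbf S(t))$, makes all queues strongly stable, $\limsup_t\frac1t\sum_{\tau<t}\mathbb E[Q_i(\tau)]<\infty$. (The theorem is also asserted with $\Lambda$ replaced by the explicit set $\sum_{\mathbf s}\mathbb P(\mathbf S=\mathbf s)\,\mathrm{conv}\{0,\ \sum_j v_{ij}(\mathbf s)\,\vec{\mathbf 1}_i:\ 1\le i\le N\}$, where $\vec{\mathbf 1}_i$ is the $i$-th coordinate vector.) The delay of a packet that arrives in slot $a$ and is delivered in slot $d$ is $d-a$, each queue being served first in, first out. The average delay $\overline D$ is the limit as $T\to\infty$ of the average delay of the packets, of all users, that arrive in the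 slots $0,\dots,T-1$. **Theorem.** Assume $\boldsymbol\lambda\in\mathrm{int}\,\Lambda$ and let the MaxWeight policy be used. Then $\mu>0$ and $\sum_j\lambda_j>0$; there is $\rho\in(0,1)$ with $\boldsymbol\lambda\in\rho\Lambda$; there is $K<\infty$ with $\mathbb E[\mu_i(t)^2]<K\,\mathbb E[A_i^2]<\infty$ for all $i$ and $t$; the average delay exists almost surely and equals a finite constant $\overline D$; and for every $\rho\in(0,1)$ with $\boldsymbol\lambda\in\rho\Lambda$ and every $K$ with $\mathbb E[\mu_i(t)^2]\le K\,\mathbb E[A_i^2]$ for all $i,t$, $$\overline D\ \le\ \frac{N(1+K)\sum_{i=1}^N\mathbb E[A_i^2]}{2\mu(1-\rho)\sum_{j=1}^N\mathbb E[A_j]}.$$ Hence $\overline D=O(N/(1-\rho))$: if $\sum_i\mathbb E[A_i^2]\le b\sum_j\mathbb E[A_j]$ and $\mu\ge m>0$, then $\overline D\le\frac{(1+K)b}{2m}\cdot\frac{N}{1-\rho}$. -/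

import Mathlib

open MeasureTheory ProbabilityTheory Filter Topology Set
open scoped NNReal ENNReal Pointwise

noncomputable section

/-- The service `μ_i` offered to user `i` in a slot when user `I j` is scheduled on channel `j` at
rate `R j` and the channel states are `x`: the transmission on channel `j` succeeds if and only if
`R j ≤ x (I j) j`. -/
def offeredService {N M : ℕ} (I : Fin M → Fin N) (R : Fin M → ℕ) (x : Fin N → Fin M → ℕ)
    (i : Fin N) : ℕ :=
  ∑ j, if I j = i ∧ R j ≤ x i j then R j else 0

/-- One slot of the queue recursion `Q_i ↦ (Q_i - μ_i)⁺ + A_i`; the truncated subtraction of `ℕ`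
is the positive part. -/
def queueStep {N M : ℕ} (q : Fin N → ℕ) (I : Fin M → Fin N) (R : Fin M → ℕ)
    (x : Fin N → Fin M → ℕ) (a : Fin N → ℕ) : Fin N → ℕ :=
  fun i => (q i - offeredService I R x i) + a i

/-- A downlink with `N` users and `M` channels, on a probability space `(Ω, P)`.
Slot `t` carries the arrivals `A t`, the channel states `X t` and the channel estimates `S t`;
the triples are i.i.d. over the slots and independent of the initial queue lengths `Q0`.
Within a slot arbitrary dependence is allowed. -/
structure Downlink (N M : ℕ) (σ : Type*) [MeasurableSpace σ]
    {Ω : Type*} [MeasurableSpace Ω] (P : Measure Ω) where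
  /-- the set of possible channel states (numbers of packets) -/
  states : Set ℕ
  A : ℕ → Ω → Fin N → ℕ
  X : ℕ → Ω → Fin N → Fin M → ℕ
  S : ℕ → Ω → Fin N → Fin M → σ
  Q0 : Ω → Fin N → ℕ
  measurable_A : ∀ t, Measurable (A t)
  measurable_X : ∀ t, Measurable (X t)
  measurable_S : ∀ t, Measurable (S t)
  measurable_Q0 : Measurable Q0
  X_mem : ∀ t ω i j, X t ω i j ∈ states
  indep : iIndepFun (fun t ω => (A t ω, X t ω, S t ω)) P
  identDistrib : ∀ t, IdentDistrib (fun ω => (A t ω, X t ω, S t ω))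
    (fun ω => (A 0 ω, X 0 ω, S 0 ω)) P P
  indep_init : IndepFun Q0 (fun ω t => (A t ω, X t ω, S t ω)) P
  memLp_A : ∀ i, MemLp (fun ω => (A 0 ω i : ℝ)) 2 P
  memLp_X : ∀ i j, MemLp (fun ω => (X 0 ω i j : ℝ)) 2 P

namespace Downlink

section
variable {N M : ℕ} {σ : Type*} [MeasurableSpace σ] {Ω : Type*} [MeasurableSpace Ω]
  {P : Measure Ω} (D : Downlink N M σ P)

/-- The arrival rate vector `λ`. -/
def rate (i : Fin N) : ℝ := ∫ ω, (D.A 0 ω i : ℝ) ∂P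

/-- The second moment `E[A_i²]` of the arrivals of user `i` in a slot. -/
def arrivalSq (i : Fin N) : ℝ := ∫ ω, (D.A 0 ω i : ℝ) ^ 2 ∂P

/-- The probability mass function of the channel estimate. -/
def estProb (s : Fin N → Fin M → σ) : ℝ := P.real (D.S 0 ⁻¹' {s})

/-- The expected goodput `P(X_ij ≥ x | S = s) x` of rate `x`. -/
def goodput (s : Fin N → Fin M → σ) (i : Fin N) (j : Fin M) (x : ℕ) : ℝ :=
  (P[|D.S 0 ⁻¹' {s}]).real {ω | x ≤ D.X 0 ω i j} * x

/-- The rate `r*_ij(s)`: the smallest maximizer of the goodput over the channel states. -/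
def bestRate (s : Fin N → Fin M → σ) (i : Fin N) (j : Fin M) : ℕ :=
  sInf {x | x ∈ D.states ∧ ∀ y ∈ D.states, D.goodput s i j y ≤ D.goodput s i j x}

/-- The maximal goodput of user `i` on channel `j` given the estimate `s`. -/
def bestGoodput (s : Fin N → Fin M → σ) (i : Fin N) (j : Fin M) : ℝ :=
  D.goodput s i j (D.bestRate s i j)

/-- The maximal mean service rate of user `i` when it is served alone on all channels. -/
def userRate (i : Fin N) : ℝ := ∑' s, D.estProb s * ∑ j, D.bestGoodput s i j

/-- The set `∑_s P(S = s) conv {0, (∑_j P(X_ij ≥ r*_ij(s) | S = s) r*_ij(s)) e_i : i}`, a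
(countable) Minkowski sum over the channel estimates `s`. -/
def explicitRegion : Set (Fin N → ℝ) :=
  {l | ∃ y : (Fin N → Fin M → σ) → (Fin N → ℝ),
    (∀ s, y s ∈ convexHull ℝ
      (insert 0 (range fun i : Fin N => Pi.single i (∑ j, D.bestGoodput s i j)))) ∧
    HasSum (fun s => D.estProb s • y s) l}

end

section
variable {N M : ℕ} {σ : Type*} [MeasurableSpace σ] [Countable σ] [MeasurableSingletonClass σ]
  {Ω : Type*} [MeasurableSpace Ω] {P : Measure Ω} [IsProbabilityMeasure P]
  (D : Downlink N M σ P)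

/-- The joint law of channel states and channel estimates in a slot. -/
def channelLaw : PMF ((Fin N → Fin M → ℕ) × (Fin N → Fin M → σ)) :=
  haveI : IsProbabilityMeasure (P.map fun ω => (D.X 0 ω, D.S 0 ω)) :=
    Measure.isProbabilityMeasure_map
      ((D.measurable_X 0).prodMk (D.measurable_S 0)).aemeasurable
  (P.map fun ω => (D.X 0 ω, D.S 0 ω)).toPMF

/-- The law of the queue lengths in slot `t`, starting with empty queues, for arrivals that are
i.i.d. over the slots with law `α` and independent of the channels, when the scheduled users and
the rates are drawn from `π q s` in a slot with queue lengths `q` and channel estimate `s`. -/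
def policyQueueLaw (π : (Fin N → ℕ) → (Fin N → Fin M → σ) → PMF (Fin M → Fin N × ℕ))
    (α : PMF (Fin N → ℕ)) : ℕ → PMF (Fin N → ℕ)
  | 0 => PMF.pure 0
  | t + 1 => (policyQueueLaw π α t).bind fun q => D.channelLaw.bind fun c =>
      (π q c.2).bind fun d => α.map fun a =>
        queueStep q (fun j => (d j).1) (fun j => (d j).2) c.1 a

/-- Strong stability of all queues: `limsup_t (1/t) ∑_{τ<t} E[Q_i(τ)] < ∞` for every `i`. -/
def StronglyStable (π : (Fin N → ℕ) → (Fin N → Fin M → σ) → PMF (Fin M → Fin N × ℕ))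
    (α : PMF (Fin N → ℕ)) : Prop :=
  ∀ i, limsup (fun t : ℕ => (∑ τ ∈ Finset.range t,
    ∑' q, D.policyQueueLaw π α τ q * (q i : ℝ≥0∞)) / (t : ℝ≥0∞)) atTop < ⊤

/-- `l` is stably supported: some (possibly randomized) stationary policy, deciding on the basis of
the current queue lengths and channel estimate, makes the network strongly stable for an arrival
law with mean vector `l` and finite second moments. -/
def StablySupported (l : Fin N → ℝ) : Prop :=
  ∃ (π : (Fin N → ℕ) → (Fin N → Fin M → σ) → PMF (Fin M → Fin N × ℕ)) (α : PMF (Fin N → ℕ)),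
    (∀ i, (∑' a, α a * (a i : ℝ≥0∞) ^ 2) < ⊤) ∧
    (∀ i, HasSum (fun a => (α a).toReal * (a i : ℝ)) (l i)) ∧
    D.StronglyStable π α

/-- The network stability region: the closure of the stably supported arrival rates. -/
def stabilityRegion : Set (Fin N → ℝ) := closure {l | D.StablySupported l}

end

section
variable {N M : ℕ} [NeZero N] {σ : Type*} [MeasurableSpace σ] {Ω : Type*} [MeasurableSpace Ω]
  {P : Measure Ω} (D : Downlink N M σ P)

/-- `μ`, the minimum over the users of the single-user maximal service rate. -/
def minUserRate : ℝ := Finset.univ.inf' Finset.univ_nonempty D.userRate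

open Classical in
/-- The users that maximize the product of backlog, success probability and rate. -/
def maxWeightUsers (q : Fin N → ℕ) (s : Fin N → Fin M → σ) (j : Fin M) : Finset (Fin N) :=
  Finset.univ.filter fun i => ∀ k, q k * D.bestGoodput s k j ≤ q i * D.bestGoodput s i j

theorem maxWeightUsers_nonempty (q : Fin N → ℕ) (s : Fin N → Fin M → σ) (j : Fin M) :
    (D.maxWeightUsers q s j).Nonempty := by
  obtain ⟨i, hi⟩ := Finite.exists_max fun i : Fin N => q i * D.bestGoodput s i j
  exact ⟨i, by simpa [maxWeightUsers] using hi⟩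

/-- The user scheduled by MaxWeight on channel `j`: the maximizing user of smallest index. -/
def mwUser (q : Fin N → ℕ) (s : Fin N → Fin M → σ) (j : Fin M) : Fin N :=
  (D.maxWeightUsers q s j).min' (D.maxWeightUsers_nonempty q s j)

/-- The rate used by MaxWeight on channel `j`. -/
def mwRate (q : Fin N → ℕ) (s : Fin N → Fin M → σ) (j : Fin M) : ℕ :=
  D.bestRate s (D.mwUser q s j) j

/-- The queue lengths under MaxWeight. -/
def Q : ℕ → Ω → Fin N → ℕ
  | 0, ω => D.Q0 ω
  | t + 1, ω => queueStep (Q t ω) (D.mwUser (Q t ω) (D.S t ω)) (D.mwRate (Q t ω) (D.S t ω))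
      (D.X t ω) (D.A t ω)

/-- The service `μ_i(t)` offered under MaxWeight. -/
def service (t : ℕ) (ω : Ω) (i : Fin N) : ℕ :=
  offeredService (D.mwUser (D.Q t ω) (D.S t ω)) (D.mwRate (D.Q t ω) (D.S t ω)) (D.X t ω) i

/-- A one-slot transition of positive probability of the Markov chain `Q`. -/
def Transition (q q' : Fin N → ℕ) : Prop :=
  0 < P {ω | queueStep q (D.mwUser q (D.S 0 ω)) (D.mwRate q (D.S 0 ω)) (D.X 0 ω) (D.A 0 ω) = q'}

/-- The chain `Q` is irreducible on some state space: a set of queue-length vectors that contains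
the initial state, is closed under transitions, and any two elements of which communicate. -/
def Irreducible : Prop :=
  ∃ E : Set (Fin N → ℕ), (∀ᵐ ω ∂P, D.Q0 ω ∈ E) ∧
    (∀ q ∈ E, ∀ q', D.Transition q q' → q' ∈ E) ∧
    ∀ q ∈ E, ∀ q' ∈ E, Relation.ReflTransGen D.Transition q q'

/-- The packets of user `i` that entered its queue before the beginning of slot `t` (including the
initial ones). The packets of user `i` are numbered `0, 1, 2, …` in order of entry. -/
def entered (t : ℕ) (ω : Ω) (i : Fin N) : ℕ := D.Q0 ω i + ∑ τ ∈ Finset.range t, D.A τ ω i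

/-- The number of packets that left queue `i` before the beginning of slot `t`. -/
def departed (t : ℕ) (ω : Ω) (i : Fin N) : ℕ :=
  ∑ τ ∈ Finset.range t, min (D.Q τ ω i) (D.service τ ω i)

/-- The delay (possibly infinite) of packet number `n` of user `i`, each queue being served first
in, first out: the number of slots at the beginning of which the packet is in the queue. For a
packet that arrives in slot `a` and is delivered in slot `d` this is `d - a`. -/
def packetDelay (ω : Ω) (i : Fin N) (n : ℕ) : ℕ∞ :=
  {t : ℕ | D.departed t ω i ≤ n ∧ n < D.entered t ω i}.encard

/-- The average delay of the packets, of all users, that arrive in the slots `0, …, T - 1`. -/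
def averageDelay (T : ℕ) (ω : Ω) : ℝ≥0∞ :=
  (∑ i, ∑ n ∈ Finset.Ico (D.Q0 ω i) (D.entered T ω i), (D.packetDelay ω i n : ℝ≥0∞)) /
    ((∑ i, ∑ τ ∈ Finset.range T, D.A τ ω i : ℕ) : ℝ≥0∞)

end

end Downlink

end

set_option linter.unusedSectionVars false

/-! Write Ψ(w) for `maxWeightedService w`: the largest mean of the service weighted by w that any
decision rule can extract from one slot. MaxWeight attains it at w = Q(t), because the maximization
splits over channels and estimates.

Capacity. A rate vector l in either version of Λ satisfies w·l ≤ Ψ(w) for every w ∈ ℕ^N. For the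
explicit set the vertices of each convex hull obey the inequality given s. For a stabilizing policy,
a violation would make E[w·Q(t)] grow linearly. Both versions therefore lie in `outerRegion`, and
the argument needs only this inclusion and λ ∈ int Λ.

Drift. Take V(q) = ∑ q_i². One slot changes its mean by at most ∑ E[A_i²] + ∑ E[μ_i²] + 2 q·λ −
2Ψ(q). If λ ∈ ρΛ, then q·λ ≤ ρΨ(q). On each channel the maximum over users is at least their
average, so NΨ(q) ≥ μ ∑ q_i. This leaves a drift of −2(1−ρ)(μ/N) ∑ q_i (`mw_drift`).

Long-run averages. Foster's criterion (`cycleMean_ne_top_of_drift`) makes the mean length of a cycle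
between visits to a state z, and the mean backlog summed over it, finite. Cycles are independent
copies of each other, so the strong law gives almost sure limits f of the backlog and s of ∑ μ_i²
(`ae_tendsto_average`). Summing the drift over a cycle, V starts and ends at V(z) and cancels
(`cycleMean_le_cycleMean_of_drift`), so 2(1−ρ)(μ/N) f ≤ ∑ E[A_i²] + s. Fatou's lemma gives s ≤ K ∑
E[A_i²]. Working with cycles avoids constructing a stationary law and any moment condition on Q(0).

Delay. Little's law on a sample path (`tendsto_averageDelay`) identifies the average delay as f / ∑
λ_j. -/

noncomputable section

/-! ### Laws of i.i.d. sequences: first term, shift, independence of past and future. -/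

section Sequences

variable {Ξ : Type*}

/-- The sequence with first term `a` and remaining terms `x`. -/
def seqCons (a : Ξ) (x : ℕ → Ξ) : ℕ → Ξ
  | 0 => a
  | n + 1 => x n

/-- The sequence `x` without its first `n` terms. -/
def seqShift (n : ℕ) (x : ℕ → Ξ) : ℕ → Ξ := fun k => x (n + k)

theorem seqShift_seqShift (m n : ℕ) (x : ℕ → Ξ) :
    seqShift n (seqShift m x) = seqShift (m + n) x := by
  funext k; simp [seqShift, add_assoc]

theorem seqShift_succ_seqCons (n : ℕ) (a : Ξ) (x : ℕ → Ξ) :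
    seqShift (n + 1) (seqCons a x) = seqShift n x := by
  funext k; simp [seqShift, add_right_comm, seqCons]

variable [MeasurableSpace Ξ]

theorem measurable_seqCons : Measurable fun p : Ξ × (ℕ → Ξ) => seqCons p.1 p.2 := by
  rw [measurable_pi_iff]
  rintro (_ | n)
  · exact measurable_fst
  · exact (measurable_pi_apply n).comp measurable_snd

theorem measurable_seqShift (n : ℕ) : Measurable (seqShift n : (ℕ → Ξ) → ℕ → Ξ) := by
  rw [measurable_pi_iff]
  exact fun k => measurable_pi_apply _

variable (ν : Measure Ξ) [IsProbabilityMeasure ν]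

/-- The law of a sequence of independent random variables with law `ν`. -/
abbrev iidLaw : Measure (ℕ → Ξ) := Measure.infinitePi fun _ => ν

theorem map_seqCons : (ν.prod (iidLaw ν)).map (fun p => seqCons p.1 p.2) = iidLaw ν := by
  classical
  refine Measure.eq_infinitePi _ fun s t ht => ?_
  obtain ⟨n, hn⟩ : ∃ n, s ⊆ Finset.range (n + 1) :=
    ⟨s.sup id, fun i hi => Finset.mem_range_succ_iff.2 (Finset.le_sup (f := id) hi)⟩
  -- Padding the cylinder with `univ` makes its index set an initial segment, from which coordinate
  -- 0 splits off.
  set t' : ℕ → Set Ξ := fun i => if i ∈ s then t i else univ with ht'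
  have ht'm : ∀ i, MeasurableSet (t' i) := fun i => by
    simp only [ht']; split_ifs
    exacts [ht i, MeasurableSet.univ]
  have h1 : (fun p : Ξ × (ℕ → Ξ) => seqCons p.1 p.2) ⁻¹' Set.pi s t
      = t' 0 ×ˢ Set.pi (Finset.range n) fun i => t' (i + 1) := by
    ext ⟨a, x⟩
    simp only [mem_preimage, Set.mem_pi, mem_prod, ht', Finset.mem_coe]
    constructor
    · intro h
      refine ⟨?_, fun i _ => ?_⟩
      · split_ifs with h0
        exacts [h 0 h0, mem_univ _]
      · split_ifs with h0
        exacts [h (i + 1) h0, mem_univ _]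
    · rintro ⟨h0, h1⟩ (_ | i) hi
      · simpa [hi, seqCons] using h0
      · have := h1 i (by have := Finset.mem_range.1 (hn hi); simp; omega)
        simpa [hi, seqCons] using this
  rw [Measure.map_apply measurable_seqCons (MeasurableSet.pi s.countable_toSet fun i _ => ht i), h1,
    Measure.prod_prod, Measure.infinitePi_pi _ (fun i _ => ht'm _)]
  have h2 := Finset.prod_range_succ' (fun i => ν (t' i)) n
  rw [mul_comm, ← h2, ← Finset.prod_subset hn]
  · exact Finset.prod_congr rfl fun i hi => by simp [ht', hi]
  · intro i _ hi; simp [ht', hi]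

theorem lintegral_iidLaw {g : (ℕ → Ξ) → ℝ≥0∞} (hg : Measurable g) :
    ∫⁻ x, g x ∂iidLaw ν = ∫⁻ a, ∫⁻ x, g (seqCons a x) ∂iidLaw ν ∂ν := by
  conv_lhs => rw [← map_seqCons ν]
  rw [lintegral_map hg measurable_seqCons, lintegral_prod]
  exact (hg.comp measurable_seqCons).aemeasurable

theorem iidLaw_apply {D : Set (ℕ → Ξ)} (hD : MeasurableSet D) :
    iidLaw ν D = ∫⁻ a, iidLaw ν {x | seqCons a x ∈ D} ∂ν := by
  rw [← lintegral_indicator_one hD, lintegral_iidLaw ν (measurable_one.indicator hD)]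
  refine lintegral_congr fun a => ?_
  have hDa : MeasurableSet {x | seqCons a x ∈ D} :=
    (measurable_seqCons.comp (measurable_prodMk_left (x := a))) hD
  rw [← lintegral_indicator_one hDa]
  rfl

theorem measurePreserving_seqShift (n : ℕ) :
    MeasurePreserving (seqShift n) (iidLaw ν) (iidLaw ν) := by
  induction n with
  | zero =>
    have : (seqShift 0 : (ℕ → Ξ) → ℕ → Ξ) = id := by
      funext x k; simp [seqShift]
    rw [this]; exact MeasurePreserving.id _
  | succ n ih =>
    refine ⟨measurable_seqShift _, ?_⟩
    conv_lhs => rw [← map_seqCons ν]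
    rw [Measure.map_map (measurable_seqShift _) measurable_seqCons]
    have : (seqShift (n + 1) ∘ fun p : Ξ × (ℕ → Ξ) => seqCons p.1 p.2) = seqShift n ∘ Prod.snd := by
      funext p; exact seqShift_succ_seqCons n p.1 p.2
    rw [this, ← Measure.map_map (measurable_seqShift _) measurable_snd]
    have h2 : (ν.prod (iidLaw ν)).map Prod.snd = iidLaw ν := by
      rw [Measure.map_snd_prod]; simp
    rw [h2, ih.map_eq]

/-- Induction on `n`, integrating out the first term each time. At `n = 0` the event depends on
nothing, hence is empty or everything. -/
theorem iidLaw_inter_seqShift (n : ℕ) {D B : Set (ℕ → Ξ)} (hD : MeasurableSet D)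
    (hdep : ∀ x y : ℕ → Ξ, (∀ k < n, x k = y k) → (x ∈ D ↔ y ∈ D)) (hB : MeasurableSet B) :
    iidLaw ν (D ∩ seqShift n ⁻¹' B) = iidLaw ν D * iidLaw ν B := by
  induction n generalizing D with
  | zero =>
    have h0 : (seqShift 0 : (ℕ → Ξ) → ℕ → Ξ) = id := by
      funext x k; simp [seqShift]
    rcases D.eq_empty_or_nonempty with rfl | ⟨x, hx⟩
    · simp
    · have : D = univ := eq_univ_of_forall fun y => (hdep x y (by simp)).1 hx
      simp [this, h0]
  | succ n ih =>
    rw [iidLaw_apply ν (hD.inter (measurable_seqShift _ hB)), iidLaw_apply ν hD,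
      ← lintegral_mul_const' _ _ (measure_ne_top _ _)]
    refine lintegral_congr fun a => ?_
    have hDa : MeasurableSet {x | seqCons a x ∈ D} :=
      (measurable_seqCons.comp (measurable_prodMk_left (x := a))) hD
    rw [← ih hDa]
    · congr 1
      ext x
      simp [seqShift_succ_seqCons]
    · intro x y hxy
      refine hdep _ _ ?_
      rintro (_ | k) hk
      · rfl
      · exact hxy k (by omega)

end Sequences

/-! ### Trajectories of a driven recursion and their cycles at a state `z`. -/

section Trajectories

variable {S Ξ : Type*} (F : S → Ξ → S)

/-- The trajectory from `q` of the recursion `q ↦ F q a` driven by the sequence `x`. -/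
def traj (q : S) (x : ℕ → Ξ) : ℕ → S
  | 0 => q
  | n + 1 => F (traj q x n) (x n)

theorem traj_add (q : S) (x : ℕ → Ξ) (m n : ℕ) :
    traj F q x (m + n) = traj F (traj F q x m) (seqShift m x) n := by
  induction n with
  | zero => rfl
  | succ n ih => rw [← add_assoc, traj, ih, traj]; rfl

theorem traj_seqCons (q : S) (a : Ξ) (x : ℕ → Ξ) (n : ℕ) :
    traj F q (seqCons a x) (n + 1) = traj F (F q a) x n := by
  induction n with
  | zero => rfl
  | succ n ih => rw [traj, ih, traj]; rfl

theorem traj_congr (q : S) {x y : ℕ → Ξ} {n : ℕ} (h : ∀ k < n, x k = y k) :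
    traj F q x n = traj F q y n := by
  induction n with
  | zero => rfl
  | succ n ih => rw [traj, traj, ih fun k hk => h k (hk.trans n.lt_succ_self), h n n.lt_succ_self]

/-- The first positive time at which the trajectory from `q` is in `z` (`0` if there is none). -/
def returnTime (z q : S) (x : ℕ → Ξ) : ℕ := sInf {n | 0 < n ∧ traj F q x n = z}

theorem returnTime_eq_iff (z q : S) (x : ℕ → Ξ) {n : ℕ} (hn : 0 < n) :
    returnTime F z q x = n ↔ traj F q x n = z ∧ ∀ k < n, 0 < k → traj F q x k ≠ z := by
  constructor
  · rintro rfl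
    have hne : {n | 0 < n ∧ traj F q x n = z}.Nonempty := Nat.nonempty_of_pos_sInf hn
    exact ⟨(Nat.sInf_mem hne).2, fun k hk h0 h => Nat.notMem_of_lt_sInf hk ⟨h0, h⟩⟩
  · rintro ⟨h1, h2⟩
    refine le_antisymm (Nat.sInf_le ⟨hn, h1⟩) (le_csInf ⟨n, hn, h1⟩ fun k hk => ?_)
    by_contra! hlt
    exact h2 k hlt hk.1 hk.2

theorem returnTime_pos_iff (z q : S) (x : ℕ → Ξ) :
    0 < returnTime F z q x ↔ ∃ n, 0 < n ∧ traj F q x n = z := by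
  constructor
  · exact fun h => Nat.nonempty_of_pos_sInf h
  · exact fun h => (Nat.sInf_mem (s := {n | 0 < n ∧ traj F q x n = z}) h).1

theorem traj_returnTime {z q : S} {x : ℕ → Ξ} (h : 0 < returnTime F z q x) :
    traj F q x (returnTime F z q x) = z :=
  ((returnTime_eq_iff F z q x h).1 rfl).1

theorem avoid_iff_lt_returnTime {z q : S} {x : ℕ → Ξ} (h : 0 < returnTime F z q x) (t : ℕ) :
    (∀ k < t, traj F q x (k + 1) ≠ z) ↔ t < returnTime F z q x := by
  constructor
  · intro h1
    by_contra! hlt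
    refine h1 (returnTime F z q x - 1) (by omega) ?_
    rw [Nat.sub_add_cancel h]
    exact traj_returnTime F h
  · intro h1 k hk
    exact ((returnTime_eq_iff F z q x h).1 rfl).2 (k + 1) (by omega) k.succ_pos

/-- The reward collected before the first return to `z`. -/
def cycleReward (z : S) (r : S → Ξ → ℕ) (x : ℕ → Ξ) : ℕ :=
  ∑ t ∈ Finset.range (returnTime F z z x), r (traj F z x t) (x t)

/-- The driving sequence from the first return to `z` on. -/
def nextCycle (z : S) (x : ℕ → Ξ) : ℕ → Ξ := seqShift (returnTime F z z x) x

/-- The time of the `n`-th return to `z`. -/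
def cycleStart (z : S) (x : ℕ → Ξ) (n : ℕ) : ℕ :=
  ∑ k ∈ Finset.range n, returnTime F z z ((nextCycle F z)^[k] x)

/-- Later cycles become first cycles of the iterates of one map on sequences, so statements about
random return times reduce to the first return. -/
theorem nextCycle_iterate {z : S} {x : ℕ → Ξ}
    (h : ∀ k, 0 < returnTime F z z ((nextCycle F z)^[k] x)) (n : ℕ) :
    (nextCycle F z)^[n] x = seqShift (cycleStart F z x n) x ∧ traj F z x (cycleStart F z x n) = z := by
  induction n with
  | zero => exact ⟨by funext k; simp [seqShift, cycleStart], rfl⟩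
  | succ n ih =>
    have h1 : cycleStart F z x (n + 1)
        = cycleStart F z x n + returnTime F z z ((nextCycle F z)^[n] x) := by
      simp [cycleStart, Finset.sum_range_succ]
    constructor
    · rw [Function.iterate_succ_apply', nextCycle, h1, ← seqShift_seqShift, ← ih.1]
    · rw [h1, traj_add, ih.2, ← ih.1, traj_returnTime F (h n)]

theorem sum_cycleReward {z : S} {x : ℕ → Ξ} (r : S → Ξ → ℕ)
    (h : ∀ k, 0 < returnTime F z z ((nextCycle F z)^[k] x)) (n : ℕ) :
    ∑ k ∈ Finset.range n, cycleReward F z r ((nextCycle F z)^[k] x)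
      = ∑ t ∈ Finset.range (cycleStart F z x n), r (traj F z x t) (x t) := by
  induction n with
  | zero => simp [cycleStart]
  | succ n ih =>
    have h1 : cycleStart F z x (n + 1)
        = cycleStart F z x n + returnTime F z z ((nextCycle F z)^[n] x) := by
      simp [cycleStart, Finset.sum_range_succ]
    rw [Finset.sum_range_succ, ih, h1, Finset.sum_range_add]
    congr 1
    refine Finset.sum_congr rfl fun t _ => ?_
    obtain ⟨h2, h3⟩ := nextCycle_iterate F h n
    rw [traj_add, h3, ← h2]
    nth_rewrite 2 [h2]
    rfl

end Trajectories

/-- A law of large numbers along a subsequence passes to the whole sequence of partial sums. -/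
theorem tendsto_div_of_subseq {u : ℕ → ℝ} (hu : Monotone u) {c : ℕ → ℕ} (hc : StrictMono c)
    {m r : ℝ} (hm : 0 < m) (h1 : Tendsto (fun n => (c n : ℝ) / n) atTop (𝓝 m))
    (h2 : Tendsto (fun n => u (c n) / n) atTop (𝓝 r)) :
    Tendsto (fun n => u n / n) atTop (𝓝 (r / m)) := by
  have hcpos : ∀ n, 0 < n → (0 : ℝ) < c n := fun n hn => by
    exact_mod_cast (hn.trans_le (hc.id_le n))
  have hratio : Tendsto (fun n => (c (n + 1) : ℝ) / c n) atTop (𝓝 1) := by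
    have h3 : Tendsto (fun n : ℕ => (c (n + 1) : ℝ) / ((n + 1 : ℕ) : ℝ)) atTop (𝓝 m) :=
      h1.comp (tendsto_add_atTop_nat 1)
    have h4 : Tendsto (fun n : ℕ => ((n + 1 : ℕ) : ℝ) / n) atTop (𝓝 1) := by
      have : Tendsto (fun n : ℕ => 1 + 1 / (n : ℝ)) atTop (𝓝 (1 + 0)) :=
        tendsto_const_nhds.add tendsto_one_div_atTop_nhds_zero_nat
      rw [add_zero] at this
      refine this.congr' ?_
      filter_upwards [eventually_gt_atTop 0] with n hn
      have : (n : ℝ) ≠ 0 := by positivity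
      push_cast; field_simp
    have h5 := (h3.mul h4).div h1 hm.ne'
    rw [mul_one, div_self hm.ne'] at h5
    refine h5.congr' ?_
    filter_upwards [eventually_gt_atTop 0] with n hn
    have h6 : (n : ℝ) ≠ 0 := by positivity
    have h7 : ((n + 1 : ℕ) : ℝ) ≠ 0 := by positivity
    have h8 := (hcpos n hn).ne'
    simp only [Pi.div_apply]
    field_simp
  refine tendsto_div_of_monotone_of_exists_subseq_tendsto_div u _ hu fun a ha =>
    ⟨c, ?_, hc.tendsto_atTop, ?_⟩
  · filter_upwards [hratio.eventually_lt_const ha, eventually_gt_atTop 0] with n hn h0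
    exact ((div_lt_iff₀ (hcpos n h0)).1 hn).le
  · refine (h2.div h1 hm.ne').congr' ?_
    filter_upwards [eventually_gt_atTop 0] with n hn
    have h6 : (n : ℝ) ≠ 0 := by positivity
    have h8 := (hcpos n hn).ne'
    simp only [Pi.div_apply]
    field_simp

/-! ### Expected rewards over a cycle, by first-step analysis. -/

section CycleMean

variable {S Ξ : Type*} [MeasurableSpace Ξ] [Countable Ξ] [MeasurableSingletonClass Ξ]
  [MeasurableSpace S] [Countable S] [MeasurableSingletonClass S]
  (F : S → Ξ → S) (ν : Measure Ξ)


theorem measurable_traj (q : S) (n : ℕ) : Measurable fun x : ℕ → Ξ => traj F q x n := by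
  induction n with
  | zero => exact measurable_const
  | succ n ih =>
    exact (Measurable.of_discrete (f := fun p : S × Ξ => F p.1 p.2)).comp
      (ih.prodMk (measurable_pi_apply n))

theorem measurable_traj_reward {β : Type*} [MeasurableSpace β] (r : S → Ξ → β) (q : S) (n : ℕ) :
    Measurable fun x : ℕ → Ξ => r (traj F q x n) (x n) :=
  (Measurable.of_discrete (f := fun p : S × Ξ => r p.1 p.2)).comp
    ((measurable_traj F q n).prodMk (measurable_pi_apply n))

theorem measurableSet_avoid (z q : S) (t : ℕ) :
    MeasurableSet {x : ℕ → Ξ | ∀ k < t, traj F q x (k + 1) ≠ z} := by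
  have : {x : ℕ → Ξ | ∀ k < t, traj F q x (k + 1) ≠ z}
      = ⋂ k, ⋂ _ : k < t, (fun x => traj F q x (k + 1)) ⁻¹' {z}ᶜ := by
    ext x; simp
  rw [this]
  exact MeasurableSet.iInter fun k => MeasurableSet.iInter fun _ =>
    measurable_traj F q _ (measurableSet_singleton z).compl

/-- The expected reward at time `t` on the event that `z` is not visited at the times
`1, …, t`. -/
def tabooMean (z : S) (g : S → Ξ → ℝ≥0∞) (t : ℕ) (q : S) : ℝ≥0∞ :=
  ∫⁻ x, {x | ∀ k < t, traj F q x (k + 1) ≠ z}.indicator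
    (fun x => g (traj F q x t) (x t)) x ∂iidLaw ν

/-- The expected reward collected before the first visit to `z` at a positive time. -/
def cycleMean (z : S) (g : S → Ξ → ℝ≥0∞) (q : S) : ℝ≥0∞ := ∑' t, tabooMean F ν z g t q

theorem cycleMean_eq_lintegral (z : S) (g : S → Ξ → ℝ≥0∞) (q : S) :
    cycleMean F ν z g q = ∫⁻ x, ∑' t, {x | ∀ k < t, traj F q x (k + 1) ≠ z}.indicator
      (fun x => g (traj F q x t) (x t)) x ∂iidLaw ν := by
  rw [lintegral_tsum]
  · rfl
  · exact fun t => ((measurable_traj_reward F g q _).indicator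
      (measurableSet_avoid F z q _)).aemeasurable

variable [IsProbabilityMeasure ν]

theorem tabooMean_zero (z : S) (g : S → Ξ → ℝ≥0∞) (q : S) :
    tabooMean F ν z g 0 q = ∫⁻ a, g q a ∂ν := by
  rw [tabooMean, lintegral_iidLaw ν ((measurable_traj_reward F g q 0).indicator
    (measurableSet_avoid F z q 0))]
  simp [traj, seqCons]

theorem tabooMean_succ (z : S) (g : S → Ξ → ℝ≥0∞) (t : ℕ) (q : S) :
    tabooMean F ν z g (t + 1) q
      = ∫⁻ a, {a | F q a ≠ z}.indicator (fun a => tabooMean F ν z g t (F q a)) a ∂ν := by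
  rw [tabooMean, lintegral_iidLaw ν ((measurable_traj_reward F g q _).indicator
    (measurableSet_avoid F z q _))]
  refine lintegral_congr fun a => ?_
  by_cases h : F q a = z
  · rw [indicator_of_notMem (by simpa using h)]
    have : ∀ x : ℕ → Ξ, seqCons a x ∉ {x : ℕ → Ξ | ∀ k < t + 1, traj F q x (k + 1) ≠ z} :=
      fun x hx => hx 0 t.succ_pos h
    rw [lintegral_congr fun x => indicator_of_notMem (this x) _]
    simp
  · rw [indicator_of_mem (by simpa using h), tabooMean]
    refine lintegral_congr fun x => ?_
    have : seqCons a x ∈ {x : ℕ → Ξ | ∀ k < t + 1, traj F q x (k + 1) ≠ z}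
        ↔ x ∈ {x : ℕ → Ξ | ∀ k < t, traj F (F q a) x (k + 1) ≠ z} := by
      constructor
      · intro hx k hk
        have := hx (k + 1) (by omega)
        rwa [traj_seqCons] at this
      · rintro hx (_ | k) hk
        · exact h
        · rw [traj_seqCons]
          exact hx k (by omega)
    by_cases h2 : x ∈ {x : ℕ → Ξ | ∀ k < t, traj F (F q a) x (k + 1) ≠ z}
    · rw [indicator_of_mem h2, indicator_of_mem (this.2 h2), traj_seqCons]; rfl
    · rw [indicator_of_notMem h2, indicator_of_notMem (fun h3 => h2 (this.1 h3))]

theorem sum_tabooMean_succ (z : S) (g : S → Ξ → ℝ≥0∞) (n : ℕ) (q : S) :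
    ∑ t ∈ Finset.range (n + 1), tabooMean F ν z g t q = ∫⁻ a, g q a ∂ν
      + ∫⁻ a, {a | F q a ≠ z}.indicator
        (fun a => ∑ t ∈ Finset.range n, tabooMean F ν z g t (F q a)) a ∂ν := by
  rw [Finset.sum_range_succ', tabooMean_zero, add_comm]
  congr 1
  simp_rw [tabooMean_succ]
  rw [← lintegral_finsetSum _ fun _ _ => Measurable.of_discrete]
  refine lintegral_congr fun a => ?_
  by_cases h : F q a = z
  · simp [h]
  · simp [h]

theorem cycleMean_eq (z : S) (g : S → Ξ → ℝ≥0∞) (q : S) :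
    cycleMean F ν z g q = ∫⁻ a, g q a ∂ν
      + ∫⁻ a, {a | F q a ≠ z}.indicator (fun a => cycleMean F ν z g (F q a)) a ∂ν := by
  rw [cycleMean, tsum_eq_zero_add' ENNReal.summable, tabooMean_zero]
  congr 1
  simp_rw [tabooMean_succ]
  rw [← lintegral_tsum fun _ => Measurable.of_discrete.aemeasurable]
  refine lintegral_congr fun a => ?_
  by_cases h : F q a = z
  · simp [h]
  · simp [h, cycleMean]

/-- On a sequence that never reaches `z` every indicator is 1, so the integrand of the mean return
time is infinite. Positivity of `returnTime` says that a return occurs, since `sInf ∅ = 0`. -/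
theorem ae_returnTime_pos {z q : S} (h : cycleMean F ν z (fun _ _ => 1) q ≠ ⊤) :
    ∀ᵐ x ∂iidLaw ν, 0 < returnTime F z q x := by
  rw [cycleMean_eq_lintegral] at h
  have hm : Measurable fun x : ℕ → Ξ => ∑' t, {x | ∀ k < t, traj F q x (k + 1) ≠ z}.indicator
      (fun _ => (1 : ℝ≥0∞)) x :=
    Measurable.tsum fun t => measurable_const.indicator (measurableSet_avoid F z q _)
  filter_upwards [ae_lt_top hm h] with x hx
  rw [returnTime_pos_iff]
  by_contra! hne
  refine hx.ne ?_
  have : ∀ t, {x | ∀ k < t, traj F q x (k + 1) ≠ z}.indicator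
      (fun _ => (1 : ℝ≥0∞)) x = 1 := fun t => by
    have hmem : x ∈ {x | ∀ k < t, traj F q x (k + 1) ≠ z} := fun k _ => hne (k + 1) k.succ_pos
    exact indicator_of_mem hmem _
  simp only [this]
  exact ENNReal.tsum_const_eq_top_of_ne_zero one_ne_zero

theorem lintegral_cycleReward {z : S} (h : ∀ᵐ x ∂iidLaw ν, 0 < returnTime F z z x)
    (r : S → Ξ → ℕ) :
    ∫⁻ x, (cycleReward F z r x : ℝ≥0∞) ∂iidLaw ν
      = cycleMean F ν z (fun q a => (r q a : ℝ≥0∞)) z := by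
  rw [cycleMean_eq_lintegral]
  refine lintegral_congr_ae ?_
  filter_upwards [h] with x hx
  rw [tsum_eq_sum (s := Finset.range (returnTime F z z x)), cycleReward]
  · push_cast
    refine Finset.sum_congr rfl fun t ht => ?_
    have hmem : x ∈ {x | ∀ k < t, traj F z x (k + 1) ≠ z} :=
      (avoid_iff_lt_returnTime F hx t).2 (Finset.mem_range.1 ht)
    rw [indicator_of_mem hmem]
  · intro t ht
    refine indicator_of_notMem (fun h2 => ht ?_) _
    exact Finset.mem_range.2 ((avoid_iff_lt_returnTime F hx t).1 h2)

end CycleMean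

/-! ### Regeneration at `z`, the strong law for cycles, and time averages. -/

section Regeneration

variable {S Ξ : Type*} [MeasurableSpace Ξ] [Countable Ξ] [MeasurableSingletonClass Ξ]
  [MeasurableSpace S] [Countable S] [MeasurableSingletonClass S]
  (F : S → Ξ → S) (ν : Measure Ξ) [IsProbabilityMeasure ν]

theorem measurableSet_returnTime_eq_of_pos (z q : S) {n : ℕ} (hn : 0 < n) :
    MeasurableSet {x : ℕ → Ξ | returnTime F z q x = n} := by
  have : {x : ℕ → Ξ | returnTime F z q x = n}
      = (fun x => traj F q x n) ⁻¹' {z} ∩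
        ⋂ k, ⋂ _ : k < n ∧ 0 < k, (fun x => traj F q x k) ⁻¹' {z}ᶜ := by
    ext x
    simp only [mem_ofPred_eq, returnTime_eq_iff F z q x hn]
    simp
  rw [this]
  exact (measurable_traj F q n (measurableSet_singleton z)).inter
    (MeasurableSet.iInter fun k => MeasurableSet.iInter fun _ =>
      measurable_traj F q k (measurableSet_singleton z).compl)

theorem measurable_returnTime (z q : S) : Measurable (returnTime F z q : (ℕ → Ξ) → ℕ) := by
  refine measurable_to_countable' fun n => ?_
  rcases Nat.eq_zero_or_pos n with rfl | hn
  · have : returnTime F z q ⁻¹' {0}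
        = (⋃ n : ℕ, {x : ℕ → Ξ | returnTime F z q x = n + 1})ᶜ := by
      ext x
      simp only [mem_preimage, mem_singleton_iff, mem_compl_iff, mem_iUnion, mem_ofPred_eq,
        not_exists]
      constructor
      · intro h n; omega
      · intro h
        by_contra h0
        exact h (returnTime F z q x - 1) (by omega)
    rw [this]
    exact (MeasurableSet.iUnion fun n =>
      measurableSet_returnTime_eq_of_pos F z q n.succ_pos).compl
  · exact measurableSet_returnTime_eq_of_pos F z q hn

theorem measurable_of_returnTime {β : Type*} [MeasurableSpace β] (z : S)
    {g : ℕ → (ℕ → Ξ) → β} (hg : ∀ n, Measurable (g n)) :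
    Measurable fun x => g (returnTime F z z x) x :=
  (measurable_from_prod_countable_right (f := fun p : ℕ × (ℕ → Ξ) => g p.1 p.2) hg).comp
    ((measurable_returnTime F z z).prodMk measurable_id)

theorem measurable_sum_reward (r : S → Ξ → ℕ) (q : S) (n : ℕ) :
    Measurable fun x : ℕ → Ξ => ∑ t ∈ Finset.range n, r (traj F q x t) (x t) :=
  Finset.measurable_sum _ fun t _ => measurable_traj_reward F r q t

theorem measurable_cycleReward (z : S) (r : S → Ξ → ℕ) :
    Measurable (cycleReward F z r) :=
  measurable_of_returnTime F z fun n => measurable_sum_reward F r z n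

theorem measurable_nextCycle (z : S) :
    Measurable (nextCycle F z : (ℕ → Ξ) → ℕ → Ξ) :=
  measurable_of_returnTime F z fun n => measurable_seqShift n

/-- The reward of the first cycle is independent of the sequence driving the later cycles, which
has the same law as the whole sequence. -/
theorem iidLaw_cycle {z : S} (h : ∀ᵐ x ∂iidLaw ν, 0 < returnTime F z z x) (r : S → Ξ → ℕ)
    (A : Set ℕ) {B : Set (ℕ → Ξ)} (hB : MeasurableSet B) :
    iidLaw ν (cycleReward F z r ⁻¹' A ∩ nextCycle F z ⁻¹' B)
      = iidLaw ν (cycleReward F z r ⁻¹' A) * iidLaw ν B := by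
  set τ : (ℕ → Ξ) → ℕ := returnTime F z z with hτ
  have hτm : Measurable τ := measurable_returnTime F z z
  have hE : MeasurableSet (cycleReward F z r ⁻¹' A) := measurable_cycleReward F z r .of_discrete
  have split : ∀ E : Set (ℕ → Ξ),
      iidLaw ν E = ∑' n, iidLaw ν (τ ⁻¹' {n} ∩ E) := fun E => by
    have h1 := tsum_measure_preimage_singleton (μ := (iidLaw ν).restrict E) (f := τ)
      (countable_univ) (fun n _ => hτm (measurableSet_singleton n))
    rw [tsum_univ fun n => ((iidLaw ν).restrict E) (τ ⁻¹' {n})] at h1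
    rw [preimage_univ, Measure.restrict_apply_univ] at h1
    rw [← h1]
    exact tsum_congr fun n => Measure.restrict_apply (hτm (measurableSet_singleton n))
  rw [split, split (cycleReward F z r ⁻¹' A), ← ENNReal.tsum_mul_right]
  refine tsum_congr fun n => ?_
  rcases Nat.eq_zero_or_pos n with rfl | hn
  · have h0 : iidLaw ν (τ ⁻¹' {0}) = 0 := by
      refine measure_mono_null ?_ h
      intro x hx
      simp only [mem_preimage, mem_singleton_iff] at hx
      simp [hx]
    rw [measure_mono_null inter_subset_left h0, measure_mono_null inter_subset_left h0, zero_mul]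
  -- On `τ = n` the cycle reward is a sum over a fixed range and `nextCycle` is a fixed shift. The
  -- event `D` is decided by the first `n` terms, so it is independent of that shift.
  · set D : Set (ℕ → Ξ) := τ ⁻¹' {n} ∩
      (fun x => ∑ t ∈ Finset.range n, r (traj F z x t) (x t)) ⁻¹' A with hD
    have hDm : MeasurableSet D := (hτm (measurableSet_singleton n)).inter
      (measurable_sum_reward F r z n .of_discrete)
    have h1 : τ ⁻¹' {n} ∩ cycleReward F z r ⁻¹' A = D := by
      ext x
      simp only [hD, mem_inter_iff, mem_preimage, mem_singleton_iff, cycleReward]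
      refine and_congr_right fun hx => ?_
      rw [← hτ, hx]
    have h2 : τ ⁻¹' {n} ∩ (cycleReward F z r ⁻¹' A ∩ nextCycle F z ⁻¹' B)
        = D ∩ seqShift n ⁻¹' B := by
      rw [← inter_assoc, h1]
      ext x
      simp only [mem_inter_iff]
      refine and_congr_right fun hx => ?_
      have hx1 : τ x = n := hx.1
      simp only [mem_preimage, nextCycle]
      rw [← hτ, hx1]
    rw [h1, h2]
    refine iidLaw_inter_seqShift ν n hDm ?_ hB
    have key : ∀ x y : ℕ → Ξ, (∀ k < n, x k = y k) → x ∈ D → y ∈ D := by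
      rintro x y hxy ⟨h3, h4⟩
      have htr : ∀ k ≤ n, traj F z x k = traj F z y k := fun k hk =>
        traj_congr F z fun i hi => hxy i (hi.trans_le hk)
      constructor
      · have h3' : returnTime F z z x = n := h3
        change returnTime F z z y = n
        rw [returnTime_eq_iff F z z _ hn] at h3' ⊢
        refine ⟨by rw [← htr n le_rfl]; exact h3'.1, fun k hk h0 => ?_⟩
        rw [← htr k hk.le]; exact h3'.2 k hk h0
      · have : ∑ t ∈ Finset.range n, r (traj F z x t) (x t)
            = ∑ t ∈ Finset.range n, r (traj F z y t) (y t) :=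
          Finset.sum_congr rfl fun t ht => by
            rw [htr t (Finset.mem_range.1 ht).le, hxy t (Finset.mem_range.1 ht)]
        simpa [← this] using h4
    exact fun x y hxy => ⟨key x y hxy, key y x fun k hk => (hxy k hk).symm⟩

theorem measurePreserving_nextCycle {z : S} (h : ∀ᵐ x ∂iidLaw ν, 0 < returnTime F z z x) :
    MeasurePreserving (nextCycle F z) (iidLaw ν) (iidLaw ν) := by
  refine ⟨measurable_nextCycle F z, Measure.ext fun B hB => ?_⟩
  rw [Measure.map_apply (measurable_nextCycle F z) hB]
  simpa using iidLaw_cycle F ν h (fun _ _ => 0) univ hB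

theorem indepFun_cycleReward_nextCycle {z : S} (h : ∀ᵐ x ∂iidLaw ν, 0 < returnTime F z z x)
    (r : S → Ξ → ℕ) : IndepFun (cycleReward F z r) (nextCycle F z) (iidLaw ν) := by
  rw [indepFun_iff_measure_inter_preimage_eq_mul]
  intro A B _ hB
  rw [iidLaw_cycle F ν h r A hB,
    (measurePreserving_nextCycle F ν h).measure_preimage hB.nullMeasurableSet]

/-- `nextCycle` preserves the law and is independent of the first reward, so the successive rewards
are identically distributed and pairwise independent, which is all the strong law needs. -/
theorem ae_tendsto_cycleReward {z : S} (h1 : cycleMean F ν z (fun _ _ => 1) z ≠ ⊤)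
    (r : S → Ξ → ℕ) (hr : cycleMean F ν z (fun q a => (r q a : ℝ≥0∞)) z ≠ ⊤) :
    ∀ᵐ x ∂iidLaw ν, Tendsto (fun n : ℕ =>
        ((∑ k ∈ Finset.range n, cycleReward F z r ((nextCycle F z)^[k] x) : ℕ) : ℝ) / n) atTop
      (𝓝 (cycleMean F ν z (fun q a => (r q a : ℝ≥0∞)) z).toReal) := by
  have h := ae_returnTime_pos F ν h1
  have hmp := measurePreserving_nextCycle F ν h
  set Y : ℕ → (ℕ → Ξ) → ℝ := fun k x => (cycleReward F z r ((nextCycle F z)^[k] x) : ℝ) with hY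
  have hYm : ∀ k, Measurable fun x : ℕ → Ξ => cycleReward F z r ((nextCycle F z)^[k] x) := fun k =>
    (measurable_cycleReward F z r).comp (hmp.iterate k).measurable
  have hcast : Measurable fun n : ℕ => (n : ℝ) := measurable_from_top
  have hY0 : Measurable (Y 0) := hcast.comp (hYm 0)
  have hlin := lintegral_cycleReward F ν h r
  have hmean : ∫ x, Y 0 x ∂iidLaw ν
      = (cycleMean F ν z (fun q a => (r q a : ℝ≥0∞)) z).toReal := by
    rw [integral_eq_lintegral_of_nonneg_ae (Eventually.of_forall fun x => by simp [hY])
      hY0.aestronglyMeasurable, ← hlin]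
    congr 1
    exact lintegral_congr fun x => by simp [hY]
  have hint : Integrable (Y 0) (iidLaw ν) := by
    refine ⟨hY0.aestronglyMeasurable, ?_⟩
    rw [hasFiniteIntegral_iff_ofReal (Eventually.of_forall fun x => by simp [hY])]
    rw [← hlin] at hr
    convert hr.lt_top using 3 with x
    simp [hY]
  -- The pair (`j`, `j + d + 1`) is the pair (0, `d + 1`) pulled back along the measure-preserving
  -- `j`-th iterate.
  have hind : ∀ j k, j < k → IndepFun (Y j) (Y k) (iidLaw ν) := fun j k hjk => by
    obtain ⟨d, rfl⟩ := Nat.exists_eq_add_of_lt hjk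
    have h2 : IndepFun (cycleReward F z r)
        (fun x => cycleReward F z r ((nextCycle F z)^[d + 1] x)) (iidLaw ν) := by
      have := (indepFun_cycleReward_nextCycle F ν h r).comp
        (φ := id) (ψ := fun y => cycleReward F z r ((nextCycle F z)^[d] y)) measurable_id (hYm d)
      exact this
    have h3 : IndepFun (fun x : ℕ → Ξ => cycleReward F z r ((nextCycle F z)^[j] x))
        (fun x => cycleReward F z r ((nextCycle F z)^[j + d + 1] x)) (iidLaw ν) := by
      rw [indepFun_iff_measure_inter_preimage_eq_mul] at h2 ⊢
      intro A B hA hB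
      have h4 := h2 A B hA hB
      have e1 : (fun x : ℕ → Ξ => cycleReward F z r ((nextCycle F z)^[j] x)) ⁻¹' A
          = ((nextCycle F z)^[j]) ⁻¹' (cycleReward F z r ⁻¹' A) := rfl
      have e2 : (fun x : ℕ → Ξ => cycleReward F z r ((nextCycle F z)^[j + d + 1] x)) ⁻¹' B
          = ((nextCycle F z)^[j]) ⁻¹'
            ((fun x => cycleReward F z r ((nextCycle F z)^[d + 1] x)) ⁻¹' B) := by
        ext x
        simp only [mem_preimage]
        rw [← Function.iterate_add_apply, show d + 1 + j = j + d + 1 by omega]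
      have mA := measurable_cycleReward F z r hA
      have mB := hYm (d + 1) hB
      rw [e1, e2, ← preimage_inter, (hmp.iterate j).measure_preimage mA.nullMeasurableSet,
        (hmp.iterate j).measure_preimage mB.nullMeasurableSet,
        (hmp.iterate j).measure_preimage (mA.inter mB).nullMeasurableSet, h4]
    exact h3.comp hcast hcast
  have hid : ∀ k, IdentDistrib (Y k) (Y 0) (iidLaw ν) (iidLaw ν) := fun k => by
    refine ⟨(hcast.comp (hYm k)).aemeasurable, hY0.aemeasurable, ?_⟩
    have : Y k = Y 0 ∘ (nextCycle F z)^[k] := rfl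
    rw [this, ← Measure.map_map hY0 (hmp.iterate k).measurable,
      (hmp.iterate k).map_eq]
  have := strong_law_ae_real Y hint (fun j k hjk => by
    rcases lt_or_gt_of_ne hjk with h5 | h5
    exacts [hind j k h5, (hind k j h5).symm]) hid
  filter_upwards [this] with x hx
  rw [← hmean]
  refine hx.congr fun n => ?_
  simp [hY]

theorem one_le_cycleMean_one (z q : S) : 1 ≤ cycleMean F ν z (fun _ _ => 1) q := by
  rw [cycleMean_eq]; simp

/-- Renewal–reward: reward and time up to the n-th return both grow linearly in n. As rewards are
nonnegative, partial sums are monotone and the limit along return times extends to all times. -/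
theorem ae_tendsto_average_self {z : S} (h1 : cycleMean F ν z (fun _ _ => 1) z ≠ ⊤)
    (r : S → Ξ → ℕ) (hr : cycleMean F ν z (fun q a => (r q a : ℝ≥0∞)) z ≠ ⊤) :
    ∀ᵐ x ∂iidLaw ν, Tendsto (fun n : ℕ =>
        ((∑ t ∈ Finset.range n, r (traj F z x t) (x t) : ℕ) : ℝ) / n) atTop
      (𝓝 ((cycleMean F ν z (fun q a => (r q a : ℝ≥0∞)) z).toReal
        / (cycleMean F ν z (fun _ _ => 1) z).toReal)) := by
  have h := ae_returnTime_pos F ν h1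
  have hmp := measurePreserving_nextCycle F ν h
  have hall : ∀ᵐ x ∂iidLaw ν, ∀ k, 0 < returnTime F z z ((nextCycle F z)^[k] x) :=
    ae_all_iff.2 fun k => (hmp.iterate k).quasiMeasurePreserving.ae h
  have hτ := ae_tendsto_cycleReward F ν h1 (fun _ _ => 1) (by simpa using h1)
  filter_upwards [hall, hτ, ae_tendsto_cycleReward F ν h1 r hr] with x hx hx1 hx2
  have hpos : 0 < (cycleMean F ν z (fun _ _ => 1) z).toReal :=
    ENNReal.toReal_pos (one_pos.trans_le (one_le_cycleMean_one F ν z z)).ne' h1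
  refine tendsto_div_of_subseq (u := fun n => ((∑ t ∈ Finset.range n, r (traj F z x t) (x t) : ℕ) : ℝ))
    (c := cycleStart F z x) ?_ ?_ hpos ?_ ?_
  · refine monotone_nat_of_le_succ fun n => ?_
    rw [Finset.sum_range_succ]; push_cast; linarith [Nat.cast_nonneg (α := ℝ) (r (traj F z x n) (x n))]
  · refine strictMono_nat_of_lt_succ fun n => ?_
    simp only [cycleStart, Finset.sum_range_succ]
    have := hx n
    omega
  · convert hx1 using 2 with n
    · simp [cycleReward, cycleStart]
    · simp
  · refine hx2.congr fun n => ?_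
    rw [sum_cycleReward F r hx]

theorem ae_tendsto_average {z q : S} (h1 : cycleMean F ν z (fun _ _ => 1) z ≠ ⊤)
    (hq : cycleMean F ν z (fun _ _ => 1) q ≠ ⊤)
    (r : S → Ξ → ℕ) (hr : cycleMean F ν z (fun q a => (r q a : ℝ≥0∞)) z ≠ ⊤) :
    ∀ᵐ x ∂iidLaw ν, Tendsto (fun n : ℕ =>
        ((∑ t ∈ Finset.range n, r (traj F q x t) (x t) : ℕ) : ℝ) / n) atTop
      (𝓝 ((cycleMean F ν z (fun q a => (r q a : ℝ≥0∞)) z).toReal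
        / (cycleMean F ν z (fun _ _ => 1) z).toReal)) := by
  -- The hitting time of `z` is random, so the limit is secured for all deterministic shifts `m` at
  -- once and then used at `m = returnTime F z q x`.
  have hall : ∀ᵐ x ∂iidLaw ν, ∀ m, Tendsto (fun n : ℕ =>
        ((∑ t ∈ Finset.range n, r (traj F z (seqShift m x) t) (seqShift m x t) : ℕ) : ℝ) / n) atTop
      (𝓝 ((cycleMean F ν z (fun q a => (r q a : ℝ≥0∞)) z).toReal
        / (cycleMean F ν z (fun _ _ => 1) z).toReal)) :=
    ae_all_iff.2 fun m => (measurePreserving_seqShift ν m).quasiMeasurePreserving.ae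
      (ae_tendsto_average_self F ν h1 r hr)
  filter_upwards [hall, ae_returnTime_pos F ν hq] with x hx hτ
  set m := returnTime F z q x
  have hm : traj F q x m = z := traj_returnTime F hτ
  rw [← tendsto_add_atTop_iff_nat m]
  have e : ∀ n, ((∑ t ∈ Finset.range (n + m), r (traj F q x t) (x t) : ℕ) : ℝ)
      = ((∑ t ∈ Finset.range m, r (traj F q x t) (x t) : ℕ) : ℝ)
        + ((∑ t ∈ Finset.range n, r (traj F z (seqShift m x) t) (seqShift m x t) : ℕ) : ℝ) := by
    intro n
    rw [add_comm n m, Finset.sum_range_add]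
    push_cast
    congr 1
    refine Finset.sum_congr rfl fun t _ => ?_
    rw [traj_add, hm]; rfl
  have h2 : Tendsto (fun n : ℕ => (n : ℝ) / ((n + m : ℕ) : ℝ)) atTop (𝓝 1) := by
    have := tendsto_natCast_div_add_atTop (𝕜 := ℝ) (m : ℝ)
    simpa using this
  have h3 : Tendsto (fun n : ℕ => ((∑ t ∈ Finset.range m, r (traj F q x t) (x t) : ℕ) : ℝ)
      / ((n + m : ℕ) : ℝ)) atTop (𝓝 0) :=
    (tendsto_const_nhds (x := ((∑ t ∈ Finset.range m, r (traj F q x t) (x t) : ℕ) : ℝ))).div_atTop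
      ((tendsto_natCast_atTop_atTop).comp (tendsto_add_atTop_nat m))
  have h4 := h3.add ((hx m).mul h2)
  rw [mul_one, zero_add] at h4
  refine h4.congr' ?_
  filter_upwards [eventually_gt_atTop 0] with n hn
  have : (n : ℝ) ≠ 0 := by positivity
  have h6 : ((n + m : ℕ) : ℝ) ≠ 0 := by positivity
  rw [e n]
  field_simp

end Regeneration

/-! ### Foster–Lyapunov criteria. -/

section Foster

variable {S Ξ : Type*} [MeasurableSpace Ξ]
  (F : S → Ξ → S) (ν : Measure Ξ)

open Classical in
/-- The probability that the chain from `q` does not visit `z` at the times `0, …, k`. -/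
def avoidProb (z : S) : ℕ → S → ℝ≥0∞
  | 0, q => if q = z then 0 else 1
  | k + 1, q => if q = z then 0 else ∫⁻ a, avoidProb z k (F q a) ∂ν

variable [IsProbabilityMeasure ν]

theorem avoidProb_le_one (z : S) (k : ℕ) (q : S) : avoidProb F ν z k q ≤ 1 := by
  induction k generalizing q with
  | zero => simp only [avoidProb]; split_ifs <;> simp
  | succ k ih =>
    simp only [avoidProb]
    split_ifs
    · simp
    · exact (lintegral_mono fun a => ih _).trans (by simp)

theorem avoidProb_succ_le (z : S) (k : ℕ) (q : S) :
    avoidProb F ν z (k + 1) q ≤ avoidProb F ν z k q := by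
  induction k generalizing q with
  | zero =>
    by_cases h : q = z
    · simp [avoidProb, h]
    · exact (avoidProb_le_one F ν z 1 q).trans (by simp [avoidProb, h])
  | succ k ih =>
    by_cases h : q = z
    · simp [avoidProb, h]
    · rw [avoidProb, if_neg h]
      conv_rhs => rw [avoidProb, if_neg h]
      exact lintegral_mono fun a => ih _

theorem avoidProb_antitone (z q : S) : Antitone fun k => avoidProb F ν z k q :=
  antitone_nat_of_succ_le fun k => avoidProb_succ_le F ν z k q

/-- Avoidance probabilities decrease with the horizon, so over a finite set the largest horizon and
the smallest gap serve all states. -/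
theorem exists_forall_avoidProb_le {z : S} {C : Set S} (hC : C.Finite)
    (h : ∀ q ∈ C, ∃ k, avoidProb F ν z k q < 1) :
    ∃ (m : ℕ) (δ : ℝ≥0∞), 0 < δ ∧ δ ≤ 1 ∧ ∀ q ∈ C, avoidProb F ν z m q + δ ≤ 1 := by
  induction C, hC using Set.Finite.induction_on with
  | empty => exact ⟨0, 1, by simp⟩
  | @insert q C _ _ ih =>
    obtain ⟨m, δ, h0, h1, h2⟩ := ih fun q hq => h q (mem_insert_of_mem _ hq)
    obtain ⟨k, hk⟩ := h q (mem_insert _ _)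
    refine ⟨max m k, min δ (1 - avoidProb F ν z k q), lt_min h0 (tsub_pos_of_lt hk),
      (min_le_left _ _).trans h1, ?_⟩
    rintro p (rfl | hp)
    · calc _ ≤ avoidProb F ν z k p + (1 - avoidProb F ν z k p) :=
            add_le_add (avoidProb_antitone F ν z p (le_max_right _ _)) (min_le_right _ _)
        _ = 1 := add_tsub_cancel_of_le hk.le
    · exact (add_le_add (avoidProb_antitone F ν z p (le_max_left _ _)) (min_le_left _ _)).trans
        (h2 p hp)

variable [Countable Ξ] [MeasurableSingletonClass Ξ]

/-- The sum of avoidance probabilities telescopes under one step: away from `z` its mean falls by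
one minus the last term. It never increases, and falls by a fixed amount on a finite set from which
`z` is reachable; this is what repairs a drift that is negative only outside such a set. -/
theorem lintegral_sum_avoidProb {z q : S} (hq : q ≠ z) (m : ℕ) :
    ∫⁻ a, (∑ k ∈ Finset.range m, avoidProb F ν z k (F q a)) ∂ν + 1
      = ∑ k ∈ Finset.range m, avoidProb F ν z k q + avoidProb F ν z m q := by
  rw [lintegral_finsetSum _ fun _ _ => Measurable.of_discrete, ← Finset.sum_range_succ,
    Finset.sum_range_succ']
  congr 1
  · exact Finset.sum_congr rfl fun k _ => by rw [avoidProb, if_neg hq]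
  · simp [avoidProb, hq]

theorem exists_avoidProb_lt_one_of_step {z q q' : S} (h : 0 < ν {a | F q a = q'})
    (h' : ∃ k, avoidProb F ν z k q' < 1) : ∃ k, avoidProb F ν z k q < 1 := by
  obtain ⟨k, hk⟩ := h'
  refine ⟨k + 1, ?_⟩
  rw [avoidProb]
  split_ifs
  · simp
  · have hm : MeasurableSet {a | F q a = q'} := .of_discrete
    calc ∫⁻ a, avoidProb F ν z k (F q a) ∂ν
        ≤ ∫⁻ a, ({a | F q a = q'}.indicator (fun _ => avoidProb F ν z k q') a
            + {a | F q a = q'}ᶜ.indicator (fun _ => 1) a) ∂ν := by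
          refine lintegral_mono fun a => ?_
          by_cases ha : F q a = q'
          · simp [ha]
          · simpa [ha] using avoidProb_le_one F ν z k (F q a)
      _ = avoidProb F ν z k q' * ν {a | F q a = q'} + ν {a | F q a = q'}ᶜ := by
          rw [lintegral_add_left .of_discrete, lintegral_indicator_const hm,
            lintegral_indicator_const hm.compl, one_mul]
      _ < ν {a | F q a = q'} + ν {a | F q a = q'}ᶜ := by
          refine ENNReal.add_lt_add_right (measure_ne_top _ _) ?_
          calc _ < 1 * ν {a | F q a = q'} :=
                (ENNReal.mul_lt_mul_iff_left h.ne' (measure_ne_top _ _)).2 hk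
            _ = _ := one_mul _
      _ = 1 := by rw [measure_add_measure_compl hm, measure_univ]

theorem exists_avoidProb_lt_one {z q : S}
    (h : Relation.ReflTransGen (fun q q' => 0 < ν {a | F q a = q'}) q z) :
    ∃ k, avoidProb F ν z k q < 1 := by
  induction h using Relation.ReflTransGen.head_induction_on with
  | refl => exact ⟨0, by simp [avoidProb]⟩
  | head h1 _ ih => exact exists_avoidProb_lt_one_of_step F ν h1 ih

variable [MeasurableSpace S] [Countable S] [MeasurableSingletonClass S]

/-- Off `z`, `W` pays for the current reward and for its own future mean, so by induction it
dominates every truncated sum. The start may be `z` itself, where nothing is assumed; hence its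
first step stays separate in the bound. -/
theorem cycleMean_le_of_superharmonic {E : Set S} (hE : ∀ q ∈ E, ∀ᵐ a ∂ν, F q a ∈ E) (z : S)
    (g : S → Ξ → ℝ≥0∞) (W : S → ℝ≥0∞)
    (hW : ∀ q ∈ E, q ≠ z → ∫⁻ a, W (F q a) ∂ν + ∫⁻ a, g q a ∂ν ≤ W q) {q : S} (hq : q ∈ E) :
    cycleMean F ν z g q ≤ ∫⁻ a, g q a ∂ν + ∫⁻ a, W (F q a) ∂ν := by
  have key : ∀ n, ∀ q ∈ E, q ≠ z → ∑ t ∈ Finset.range n, tabooMean F ν z g t q ≤ W q := by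
    intro n
    induction n with
    | zero => simp
    | succ n ih =>
      intro q hq hqz
      rw [sum_tabooMean_succ, add_comm]
      refine le_trans (add_le_add (lintegral_mono_ae ?_) le_rfl) (hW q hq hqz)
      filter_upwards [hE q hq] with a ha
      by_cases h : F q a = z
      · simp [h]
      · simpa [h] using ih _ ha h
  rw [cycleMean_eq]
  refine add_le_add le_rfl (lintegral_mono_ae ?_)
  filter_upwards [hE q hq] with a ha
  by_cases h : F q a = z
  · simp [h]
  · simpa [h, cycleMean] using le_of_tendsto' (ENNReal.tendsto_nat_tsum _) fun n => key n _ ha h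

/-- Foster's criterion for the mean return time and the mean reward of a cycle. -/
theorem cycleMean_ne_top_of_drift {E : Set S} (hE : ∀ q ∈ E, ∀ᵐ a ∂ν, F q a ∈ E) {z : S}
    (hz : ∀ q ∈ E, Relation.ReflTransGen (fun q q' => 0 < ν {a | F q a = q'}) q z)
    (V : S → ℝ≥0∞) (hV : ∀ q, V q ≠ ⊤) (f : S → ℕ) (hf : ∀ n, {q | f q ≤ n}.Finite)
    {c b : ℝ≥0} (hc : 0 < c)
    (hdrift : ∀ q ∈ E, ∫⁻ a, V (F q a) ∂ν + 2 * (c * f q) ≤ V q + b) {q : S} (hq : q ∈ E) :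
    cycleMean F ν z (fun q _ => 1 + c * f q) q ≠ ⊤ := by
  -- The threshold `n` makes `c * f ≥ b + 1` as soon as `f > n`. The remaining set `f ≤ n` is
  -- finite, and there `L * U` with `L = (b + 1) / δ` loses at least `b + 1`.
  obtain ⟨n, hn⟩ := exists_nat_ge ((b + 1) / c)
  have hC := (hf n).inter_of_left E
  obtain ⟨m, δ, hδ, hδ1, hmδ⟩ := exists_forall_avoidProb_le F ν (z := z) hC
    fun q hq => exists_avoidProb_lt_one F ν (hz q hq.2)
  set L : ℝ≥0∞ := (b + 1) / δ with hL
  have hδtop : δ ≠ ⊤ := (hδ1.trans_lt ENNReal.one_lt_top).ne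
  have hLδ : L * δ = b + 1 := ENNReal.div_mul_cancel hδ.ne' hδtop
  have hLtop : L ≠ ⊤ := ENNReal.div_ne_top (by simp) hδ.ne'
  set U : S → ℝ≥0∞ := fun q => ∑ k ∈ Finset.range m, avoidProb F ν z k q with hU
  have hint : ∀ q, ∫⁻ a, (V (F q a) + L * U (F q a)) ∂ν
      = ∫⁻ a, V (F q a) ∂ν + L * ∫⁻ a, U (F q a) ∂ν := fun q => by
    rw [lintegral_add_left .of_discrete, lintegral_const_mul _ .of_discrete]
  have hconst : ∀ q, ∫⁻ _, (1 + (c : ℝ≥0∞) * f q) ∂ν = 1 + c * f q := fun q => by simp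
  have hbound : cycleMean F ν z (fun q _ => 1 + c * f q) q
      ≤ (1 + c * f q) + ∫⁻ a, (V (F q a) + L * U (F q a)) ∂ν := by
    conv_rhs => rw [← hconst]
    refine cycleMean_le_of_superharmonic F ν hE z (fun q _ => 1 + c * f q)
      (fun q => V q + L * U q) ?_ hq
    intro q hq hqz
    have hUq := lintegral_sum_avoidProb F ν hqz m
    rw [hint, hconst]
    -- The drift contains `c * f` twice: one copy is the reward to be bounded; for `f > n` the other
    -- pays for `b + 1`. For `f ≤ n` the loss of `L * U` pays instead.
    by_cases hqn : f q ≤ n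
    · have h1 := hmδ q ⟨hqn, hq⟩
      have h2 : ∫⁻ a, U (F q a) ∂ν + δ ≤ U q := by
        refine (ENNReal.add_le_add_iff_right (a := avoidProb F ν z m q)
          ((avoidProb_le_one F ν z m q).trans_lt ENNReal.one_lt_top).ne).1 ?_
        calc ∫⁻ a, U (F q a) ∂ν + δ + avoidProb F ν z m q
            = ∫⁻ a, U (F q a) ∂ν + (avoidProb F ν z m q + δ) := by ring
          _ ≤ ∫⁻ a, U (F q a) ∂ν + 1 := by gcongr
          _ = _ := hUq
      refine (ENNReal.add_le_add_iff_right (a := (b : ℝ≥0∞)) ENNReal.coe_ne_top).1 ?_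
      calc ∫⁻ a, V (F q a) ∂ν + L * ∫⁻ a, U (F q a) ∂ν + (1 + c * f q) + b
          ≤ ∫⁻ a, V (F q a) ∂ν + L * ∫⁻ a, U (F q a) ∂ν + (1 + 2 * (c * f q)) + b := by
            have hle : (c : ℝ≥0∞) * f q ≤ 2 * (c * f q) := by rw [two_mul]; exact le_self_add
            exact add_le_add (add_le_add le_rfl (add_le_add le_rfl hle)) le_rfl
        _ = (∫⁻ a, V (F q a) ∂ν + 2 * (c * f q)) + L * ∫⁻ a, U (F q a) ∂ν + (b + 1) := by ring
        _ ≤ (V q + b) + L * ∫⁻ a, U (F q a) ∂ν + (b + 1) :=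
            add_le_add (add_le_add (hdrift q hq) le_rfl) le_rfl
        _ = V q + L * (∫⁻ a, U (F q a) ∂ν + δ) + b := by rw [mul_add, hLδ]; ring
        _ ≤ V q + L * U q + b := by gcongr
    · have h2 : ∫⁻ a, U (F q a) ∂ν ≤ U q := by
        refine (ENNReal.add_le_add_iff_right (a := 1) ENNReal.one_ne_top).1 ?_
        rw [hUq]
        gcongr
        exact avoidProb_le_one F ν z m q
      have h3 : (b : ℝ≥0∞) + 1 ≤ c * f q := by
        have h4 : b + 1 ≤ c * f q := by
          have h5 : (b + 1) / c ≤ (f q : ℝ≥0) :=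
            hn.trans (by exact_mod_cast (not_le.1 hqn).le)
          rw [div_le_iff₀ hc] at h5
          rwa [mul_comm]
        exact_mod_cast h4
      refine (ENNReal.add_le_add_iff_right (a := (b : ℝ≥0∞)) ENNReal.coe_ne_top).1 ?_
      calc ∫⁻ a, V (F q a) ∂ν + L * ∫⁻ a, U (F q a) ∂ν + (1 + c * f q) + b
          = ∫⁻ a, V (F q a) ∂ν + L * ∫⁻ a, U (F q a) ∂ν + (b + 1) + c * f q := by ring
        _ ≤ ∫⁻ a, V (F q a) ∂ν + L * ∫⁻ a, U (F q a) ∂ν + c * f q + c * f q := by gcongr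
        _ = (∫⁻ a, V (F q a) ∂ν + 2 * (c * f q)) + L * ∫⁻ a, U (F q a) ∂ν := by ring
        _ ≤ (V q + b) + L * U q := add_le_add (hdrift q hq) (by gcongr)
        _ = _ := by ring
  refine (hbound.trans_lt ?_).ne
  rw [hint]
  have h6 : ∫⁻ a, V (F q a) ∂ν ≠ ⊤ :=
    ((le_self_add.trans (hdrift q hq)).trans_lt
      (ENNReal.add_lt_top.2 ⟨(hV q).lt_top, ENNReal.coe_lt_top⟩)).ne
  have h7 : ∫⁻ a, U (F q a) ∂ν ≠ ⊤ := by
    refine (lt_of_le_of_lt (lintegral_mono fun a => (Finset.sum_le_sum fun k _ =>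
      avoidProb_le_one F ν z k (F q a))) ?_).ne
    simp
  refine ENNReal.add_lt_top.2 ⟨?_, ENNReal.add_lt_top.2 ⟨h6.lt_top, ?_⟩⟩
  · exact ENNReal.add_lt_top.2 ⟨by simp, ENNReal.mul_lt_top (by simp) (by simp)⟩
  · exact ENNReal.mul_lt_top hLtop.lt_top h7.lt_top

/-- A drift inequality compares the mean rewards of a cycle. -/
theorem cycleMean_le_cycleMean_of_drift {E : Set S} (hE : ∀ q ∈ E, ∀ᵐ a ∂ν, F q a ∈ E) {z : S}
    (hz : z ∈ E) (h1 : cycleMean F ν z (fun _ _ => 1) z ≠ ⊤) (V : S → ℝ≥0∞) (hV : V z ≠ ⊤)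
    (g g' : S → Ξ → ℝ≥0∞)
    (hdrift : ∀ q ∈ E, ∫⁻ a, V (F q a) ∂ν + ∫⁻ a, g q a ∂ν ≤ V q + ∫⁻ a, g' q a ∂ν) :
    cycleMean F ν z g z ≤ cycleMean F ν z g' z := by
  -- The drift is summed until the first return or time `n`. After a return `V` equals `V z`;
  -- without one, `V ≥ 0` is replaced by adding `V z` times the probability of no return by time
  -- `n`. That probability is a term of the convergent series for the mean return time, so it
  -- vanishes in the limit.
  have key : ∀ n, ∀ q ∈ E, ∑ t ∈ Finset.range n, tabooMean F ν z g t q + V z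
      ≤ V q + ∑ t ∈ Finset.range n, tabooMean F ν z g' t q
        + V z * tabooMean F ν z (fun _ _ => 1) n q := by
    intro n
    induction n with
    | zero => intro q _; simp [tabooMean_zero]
    | succ n ih =>
      intro q hq
      rw [sum_tabooMean_succ, sum_tabooMean_succ, tabooMean_succ]
      have hVz : V z = ∫⁻ _, V z ∂ν := by simp
      have h2 : ∫⁻ a, {a | F q a ≠ z}.indicator
            (fun a => ∑ t ∈ Finset.range n, tabooMean F ν z g t (F q a)) a ∂ν + V z
          ≤ ∫⁻ a, V (F q a) ∂ν + ∫⁻ a, {a | F q a ≠ z}.indicator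
            (fun a => ∑ t ∈ Finset.range n, tabooMean F ν z g' t (F q a)) a ∂ν
            + V z * ∫⁻ a, {a | F q a ≠ z}.indicator
              (fun a => tabooMean F ν z (fun _ _ => 1) n (F q a)) a ∂ν := by
        nth_rewrite 1 [hVz]
        rw [← lintegral_const_mul _ .of_discrete, ← lintegral_add_left .of_discrete,
          ← lintegral_add_left .of_discrete, ← lintegral_add_left .of_discrete]
        refine lintegral_mono_ae ?_
        filter_upwards [hE q hq] with a ha
        by_cases h : F q a = z
        · simp [h]
        · simpa [h] using ih _ ha
      calc _ = ∫⁻ a, g q a ∂ν + (∫⁻ a, {a | F q a ≠ z}.indicator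
            (fun a => ∑ t ∈ Finset.range n, tabooMean F ν z g t (F q a)) a ∂ν + V z) := by ring
        _ ≤ _ := add_le_add le_rfl h2
        _ = (∫⁻ a, V (F q a) ∂ν + ∫⁻ a, g q a ∂ν) + ∫⁻ a, {a | F q a ≠ z}.indicator
            (fun a => ∑ t ∈ Finset.range n, tabooMean F ν z g' t (F q a)) a ∂ν
            + V z * ∫⁻ a, {a | F q a ≠ z}.indicator
              (fun a => tabooMean F ν z (fun _ _ => 1) n (F q a)) a ∂ν := by ring
        _ ≤ _ := by
          rw [← add_assoc (V q)]
          exact add_le_add (add_le_add (hdrift q hq) le_rfl) le_rfl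
  have h2 : Tendsto (fun n => tabooMean F ν z (fun _ _ => 1) n z) atTop (𝓝 0) :=
    ENNReal.tendsto_atTop_zero_of_tsum_ne_top h1
  have h3 := le_of_tendsto_of_tendsto'
    ((ENNReal.tendsto_nat_tsum fun t => tabooMean F ν z g t z).add_const (V z))
    (((ENNReal.tendsto_nat_tsum fun t => tabooMean F ν z g' t z).const_add (V z)).add
      (ENNReal.Tendsto.const_mul h2 (Or.inr hV)))
    (fun n => key n z hz)
  rw [mul_zero, add_zero, add_comm] at h3
  exact (ENNReal.add_le_add_iff_left hV).1 h3

end Foster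

/-! ### Goodput: the best rate exists and beats every rate. -/

theorem exists_max_of_tendsto_zero {f : ℕ → ℝ} (h0 : ∀ n, 0 ≤ f n)
    (hf : Tendsto f atTop (𝓝 0)) {s : Set ℕ} (hs : s.Nonempty) :
    ∃ x ∈ s, ∀ y ∈ s, f y ≤ f x := by
  by_cases h : ∃ y ∈ s, 0 < f y
  · obtain ⟨y₀, hy₀, hpos⟩ := h
    obtain ⟨B, hB⟩ := eventually_atTop.1 (hf.eventually_lt_const hpos)
    obtain ⟨x, hx, hmax⟩ := Set.exists_max_image (s ∩ Iic (max B y₀)) f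
      ((finite_Iic _).inter_of_right _) ⟨y₀, hy₀, mem_Iic.2 (le_max_right _ _)⟩
    refine ⟨x, hx.1, fun y hy => ?_⟩
    by_cases hyB : y ≤ max B y₀
    · exact hmax y ⟨hy, hyB⟩
    · exact (hB y ((le_max_left _ _).trans (not_le.1 hyB).le)).le.trans
        (hmax y₀ ⟨hy₀, mem_Iic.2 (le_max_right _ _)⟩)
  · push Not at h
    obtain ⟨x, hx⟩ := hs
    exact ⟨x, hx, fun y hy => (h y hy).trans (h0 x)⟩

theorem sum_mul_offeredService {N M : ℕ} (w : Fin N → ℕ) (I : Fin M → Fin N) (R : Fin M → ℕ)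
    (x : Fin N → Fin M → ℕ) :
    ∑ i, w i * offeredService I R x i = ∑ j, w (I j) * if R j ≤ x (I j) j then R j else 0 := by
  simp only [offeredService, Finset.mul_sum]
  rw [Finset.sum_comm]
  refine Finset.sum_congr rfl fun j _ => ?_
  rw [Finset.sum_eq_single (I j)]
  · simp
  · intro i _ hi; simp [hi.symm]
  · simp

theorem offeredService_le {N M : ℕ} (I : Fin M → Fin N) (R : Fin M → ℕ)
    (x : Fin N → Fin M → ℕ) (i : Fin N) : offeredService I R x i ≤ ∑ j, x i j := by
  refine Finset.sum_le_sum fun j _ => ?_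
  split_ifs with h
  exacts [h.2, Nat.zero_le _]

namespace Downlink

section
variable {N M : ℕ} {σ : Type*} [MeasurableSpace σ] {Ω : Type*} [MeasurableSpace Ω]
  {P : Measure Ω} (D : Downlink N M σ P)

theorem estProb_nonneg (s : Fin N → Fin M → σ) : 0 ≤ D.estProb s := measureReal_nonneg

theorem goodput_nonneg (s : Fin N → Fin M → σ) (i : Fin N) (j : Fin M) (x : ℕ) :
    0 ≤ D.goodput s i j x := mul_nonneg measureReal_nonneg (Nat.cast_nonneg x)

theorem bestGoodput_nonneg (s : Fin N → Fin M → σ) (i : Fin N) (j : Fin M) :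
    0 ≤ D.bestGoodput s i j := D.goodput_nonneg s i j _

variable [Countable σ] [MeasurableSingletonClass σ] [IsProbabilityMeasure P]

theorem measurableSet_est (s : Fin N → Fin M → σ) : MeasurableSet (D.S 0 ⁻¹' {s}) :=
  D.measurable_S 0 (measurableSet_singleton s)

theorem measurable_channel (t : ℕ) (i : Fin N) (j : Fin M) : Measurable fun ω => D.X t ω i j :=
  (Measurable.of_discrete (f := fun x : Fin N → Fin M → ℕ => x i j)).comp (D.measurable_X t)

theorem measurableSet_le_channel (i : Fin N) (j : Fin M) (x : ℕ) :
    MeasurableSet {ω | x ≤ D.X 0 ω i j} :=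
  D.measurable_channel 0 i j (measurableSet_Ici (a := x))

theorem estProb_mul_goodput (s : Fin N → Fin M → σ) (i : Fin N) (j : Fin M) (x : ℕ) :
    D.estProb s * D.goodput s i j x = P.real (D.S 0 ⁻¹' {s} ∩ {ω | x ≤ D.X 0 ω i j}) * x := by
  rw [goodput, ← mul_assoc]
  congr 1
  simp only [estProb, measureReal_def]
  rw [← ENNReal.toReal_mul, mul_comm, cond_mul_eq_inter (D.measurableSet_est s)]

theorem channelSq_tail (i : Fin N) (j : Fin M) (x : ℕ) :
    (x : ℝ) ^ 2 * P.real {ω | x ≤ D.X 0 ω i j} ≤ ∫ ω, (D.X 0 ω i j : ℝ) ^ 2 ∂P := by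
  have h := mul_meas_ge_le_integral_of_nonneg (μ := P)
    (f := fun ω => (D.X 0 ω i j : ℝ) ^ 2) (Eventually.of_forall fun ω => sq_nonneg _)
    (D.memLp_X i j).integrable_sq ((x : ℝ) ^ 2)
  have e : {ω | (x : ℝ) ^ 2 ≤ (D.X 0 ω i j : ℝ) ^ 2} = {ω | x ≤ D.X 0 ω i j} := by
    ext ω
    simp only [mem_ofPred_eq]
    rw [pow_le_pow_iff_left₀ (by positivity) (by positivity) two_ne_zero, Nat.cast_le]
  rwa [e] at h

/-- A second moment gives P(X ≥ x) = O(1/x²), so x P(X ≥ x) → 0 even after dividing by P(S = s). If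
P(S = s) = 0, conditioning yields the zero measure and the goodput vanishes. The decay makes the
maximum attained over a possibly infinite set of states. -/
theorem tendsto_goodput (s : Fin N → Fin M → σ) (i : Fin N) (j : Fin M) :
    Tendsto (D.goodput s i j) atTop (𝓝 0) := by
  rcases (D.estProb_nonneg s).eq_or_lt with h0 | hpos
  · have : ∀ x, D.goodput s i j x = 0 := fun x => by
      have hz : P (D.S 0 ⁻¹' {s}) = 0 := by
        have h1 : P.real (D.S 0 ⁻¹' {s}) = 0 := h0.symm
        rwa [measureReal_eq_zero_iff] at h1
      simp [goodput, measureReal_def, cond_eq_zero_of_meas_eq_zero hz]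
    rw [funext this]; exact tendsto_const_nhds
  · set C := ∫ ω, (D.X 0 ω i j : ℝ) ^ 2 ∂P
    have hlim : Tendsto (fun x : ℕ => C / D.estProb s / (x : ℝ)) atTop (𝓝 0) :=
      tendsto_const_nhds.div_atTop tendsto_natCast_atTop_atTop
    refine squeeze_zero' (Eventually.of_forall fun x => D.goodput_nonneg s i j x) ?_ hlim
    filter_upwards [eventually_gt_atTop 0] with x hx
    have hx' : (0 : ℝ) < x := by exact_mod_cast hx
    rw [le_div_iff₀ hx', le_div_iff₀ hpos]
    calc D.goodput s i j x * x * D.estProb s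
        = (D.estProb s * D.goodput s i j x) * x := by ring
      _ = P.real (D.S 0 ⁻¹' {s} ∩ {ω | x ≤ D.X 0 ω i j}) * x * x := by rw [estProb_mul_goodput]
      _ ≤ P.real {ω | x ≤ D.X 0 ω i j} * x * x := by
          gcongr
          · finiteness
          · exact inter_subset_right
      _ = (x : ℝ) ^ 2 * P.real {ω | x ≤ D.X 0 ω i j} := by ring
      _ ≤ C := D.channelSq_tail i j x

theorem bestRate_spec (s : Fin N → Fin M → σ) (i : Fin N) (j : Fin M) :
    D.bestRate s i j ∈ D.states ∧ ∀ y ∈ D.states, D.goodput s i j y ≤ D.bestGoodput s i j := by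
  obtain ⟨ω⟩ := nonempty_of_isProbabilityMeasure P
  obtain ⟨x, hx, hmax⟩ := exists_max_of_tendsto_zero (D.goodput_nonneg s i j)
    (D.tendsto_goodput s i j) ⟨_, D.X_mem 0 ω i j⟩
  exact Nat.sInf_mem (s := {x | x ∈ D.states ∧
    ∀ y ∈ D.states, D.goodput s i j y ≤ D.goodput s i j x}) ⟨x, hx, hmax⟩

/-- No rate, even outside the set of channel states, has a goodput above the best one. -/
theorem goodput_le_bestGoodput (s : Fin N → Fin M → σ) (i : Fin N) (j : Fin M) (R : ℕ) :
    D.goodput s i j R ≤ D.bestGoodput s i j := by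
  -- Rounding `R` up to the next channel state does not change the success event and only raises the
  -- rate. If no state reaches `R`, transmission always fails.
  by_cases h : {x | x ∈ D.states ∧ R ≤ x}.Nonempty
  · have hm := Nat.sInf_mem h
    refine le_trans ?_ ((D.bestRate_spec s i j).2 _ hm.1)
    have e : {ω | R ≤ D.X 0 ω i j} = {ω | sInf {x | x ∈ D.states ∧ R ≤ x} ≤ D.X 0 ω i j} := by
      ext ω
      exact ⟨fun h => Nat.sInf_le ⟨D.X_mem 0 ω i j, h⟩, fun h => hm.2.trans h⟩
    rw [goodput, goodput, e]
    gcongr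
    exact hm.2
  · have e : {ω | R ≤ D.X 0 ω i j} = ∅ := by
      ext ω
      simp only [mem_ofPred_eq, mem_empty_iff_false, iff_false]
      exact fun h2 => h ⟨_, D.X_mem 0 ω i j, h2⟩
    rw [goodput, e]
    simpa using D.bestGoodput_nonneg s i j

theorem lintegral_eq_tsum_est (h : Ω → ℝ≥0∞) :
    ∫⁻ ω, h ω ∂P = ∑' s, ∫⁻ ω in D.S 0 ⁻¹' {s}, h ω ∂P := by
  rw [← lintegral_iUnion D.measurableSet_est]
  · have : ⋃ s, D.S 0 ⁻¹' {s} = univ := by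
      ext ω; simp
    rw [this, Measure.restrict_univ]
  · intro s s' hss
    refine Set.disjoint_left.2 fun ω h1 h2 => hss ?_
    exact h1.symm.trans h2

theorem setLIntegral_service (w : Fin N → ℕ) (I : Fin M → Fin N) (R : Fin M → ℕ)
    (s : Fin N → Fin M → σ) :
    ∫⁻ ω in D.S 0 ⁻¹' {s}, ((∑ i, w i * offeredService I R (D.X 0 ω) i : ℕ) : ℝ≥0∞) ∂P
      = ENNReal.ofReal (D.estProb s * ∑ j, w (I j) * D.goodput s (I j) j (R j)) := by
  have hset : ∀ j, MeasurableSet {ω | R j ≤ D.X 0 ω (I j) j} := fun j =>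
    D.measurableSet_le_channel _ _ _
  have e : ∀ ω, ((∑ i, w i * offeredService I R (D.X 0 ω) i : ℕ) : ℝ≥0∞)
      = ∑ j, {ω | R j ≤ D.X 0 ω (I j) j}.indicator
        (fun _ => ((w (I j) * R j : ℕ) : ℝ≥0∞)) ω := fun ω => by
    rw [sum_mul_offeredService]
    push_cast
    refine Finset.sum_congr rfl fun j _ => ?_
    by_cases h : R j ≤ D.X 0 ω (I j) j
    · simp [h]
    · simp [h]
  simp_rw [e]
  rw [lintegral_finsetSum _ fun j _ => measurable_const.indicator (hset j), Finset.mul_sum,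
    ENNReal.ofReal_sum_of_nonneg]
  · refine Finset.sum_congr rfl fun j _ => ?_
    rw [lintegral_indicator_const (hset j), Measure.restrict_apply (hset j)]
    have : D.estProb s * (w (I j) * D.goodput s (I j) j (R j))
        = ((w (I j) * R j : ℕ) : ℝ) * P.real (D.S 0 ⁻¹' {s} ∩ {ω | R j ≤ D.X 0 ω (I j) j}) := by
      rw [mul_left_comm, estProb_mul_goodput]; push_cast; ring
    rw [this, ENNReal.ofReal_mul (Nat.cast_nonneg _), ENNReal.ofReal_natCast, measureReal_def,
      ENNReal.ofReal_toReal (measure_ne_top _ _), inter_comm]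
  · exact fun j _ => mul_nonneg (D.estProb_nonneg s)
      (mul_nonneg (Nat.cast_nonneg _) (D.goodput_nonneg _ _ _ _))

end

/-! ### MaxWeight as a support function, and the capacity constraints. -/

section
variable {N M : ℕ} [NeZero N] {σ : Type*} [MeasurableSpace σ] {Ω : Type*} [MeasurableSpace Ω]
  {P : Measure Ω} (D : Downlink N M σ P)

/-- The maximal conditional mean of the service weighted by `w`, given the channel estimate `s`. -/
def maxWeightedGoodput (w : Fin N → ℕ) (s : Fin N → Fin M → σ) : ℝ :=
  ∑ j, w (D.mwUser w s j) * D.bestGoodput s (D.mwUser w s j) j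

/-- The mean of the service weighted by `w` under MaxWeight in a slot with queue lengths `w`. -/
def maxWeightedService (w : Fin N → ℕ) : ℝ≥0∞ :=
  ∑' s, ENNReal.ofReal (D.estProb s * D.maxWeightedGoodput w s)

theorem le_mwUser (w : Fin N → ℕ) (s : Fin N → Fin M → σ) (j : Fin M) (k : Fin N) :
    w k * D.bestGoodput s k j ≤ w (D.mwUser w s j) * D.bestGoodput s (D.mwUser w s j) j := by
  have h := Finset.min'_mem _ (D.maxWeightUsers_nonempty w s j)
  exact (Finset.mem_filter.1 h).2 k

theorem maxWeightedGoodput_nonneg (w : Fin N → ℕ) (s : Fin N → Fin M → σ) :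
    0 ≤ D.maxWeightedGoodput w s :=
  Finset.sum_nonneg fun _ _ => mul_nonneg (Nat.cast_nonneg _) (D.bestGoodput_nonneg _ _ _)

/-- On each channel the sum over users is at most `N` times the maximum. This is the origin of the
factor `N` in the delay bound. -/
theorem sum_mul_sum_bestGoodput_le (w : Fin N → ℕ) (s : Fin N → Fin M → σ) :
    ∑ i, w i * ∑ j, D.bestGoodput s i j ≤ N * D.maxWeightedGoodput w s := by
  simp_rw [Finset.mul_sum]
  rw [Finset.sum_comm, maxWeightedGoodput, Finset.mul_sum]
  refine Finset.sum_le_sum fun j _ => ?_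
  refine (Finset.sum_le_card_nsmul _ _ _ fun i _ => D.le_mwUser w s j i).trans ?_
  simp

theorem mul_sum_bestGoodput_le (w : Fin N → ℕ) (s : Fin N → Fin M → σ) (i : Fin N) :
    w i * ∑ j, D.bestGoodput s i j ≤ D.maxWeightedGoodput w s := by
  rw [Finset.mul_sum]
  exact Finset.sum_le_sum fun j _ => D.le_mwUser w s j i

theorem maxWeightedGoodput_single (i : Fin N) (s : Fin N → Fin M → σ) :
    D.maxWeightedGoodput (Pi.single i 1) s = ∑ j, D.bestGoodput s i j := by
  refine le_antisymm (Finset.sum_le_sum fun j _ => ?_) ?_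
  · by_cases h : D.mwUser (Pi.single i 1) s j = i
    · rw [h]; simp
    · rw [Pi.single_eq_of_ne h]; simpa using D.bestGoodput_nonneg s i j
  · simpa using D.mul_sum_bestGoodput_le (Pi.single i 1) s i

variable [Countable σ] [MeasurableSingletonClass σ] [IsProbabilityMeasure P]

theorem setLIntegral_service_le (w : Fin N → ℕ) (I : Fin M → Fin N) (R : Fin M → ℕ)
    (s : Fin N → Fin M → σ) :
    ∫⁻ ω in D.S 0 ⁻¹' {s}, ((∑ i, w i * offeredService I R (D.X 0 ω) i : ℕ) : ℝ≥0∞) ∂P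
      ≤ ENNReal.ofReal (D.estProb s * D.maxWeightedGoodput w s) := by
  rw [setLIntegral_service]
  refine ENNReal.ofReal_le_ofReal (mul_le_mul_of_nonneg_left ?_ (D.estProb_nonneg s))
  refine Finset.sum_le_sum fun j _ => le_trans ?_ (D.le_mwUser w s j (I j))
  exact mul_le_mul_of_nonneg_left (D.goodput_le_bestGoodput _ _ _ _) (Nat.cast_nonneg _)

theorem lintegral_maxWeight_service (w : Fin N → ℕ) :
    ∫⁻ ω, ((∑ i, w i * offeredService (D.mwUser w (D.S 0 ω)) (D.mwRate w (D.S 0 ω))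
      (D.X 0 ω) i : ℕ) : ℝ≥0∞) ∂P = D.maxWeightedService w := by
  rw [D.lintegral_eq_tsum_est]
  refine tsum_congr fun s => ?_
  have h := D.setLIntegral_service w (D.mwUser w s) (D.mwRate w s) s
  rw [maxWeightedGoodput]
  refine Eq.trans ?_ h
  refine setLIntegral_congr_fun (D.measurableSet_est s) fun ω hω => ?_
  have : D.S 0 ω = s := hω
  simp only [this]

theorem lintegral_channel_ne_top (i : Fin N) (j : Fin M) :
    ∫⁻ ω, (D.X 0 ω i j : ℝ≥0∞) ∂P ≠ ⊤ := by
  have h := ((D.memLp_X i j).integrable one_le_two).lintegral_lt_top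
  simpa using h.ne

theorem maxWeightedService_ne_top (w : Fin N → ℕ) : D.maxWeightedService w ≠ ⊤ := by
  rw [← lintegral_maxWeight_service]
  have hle : ∀ ω, ((∑ i, w i * offeredService (D.mwUser w (D.S 0 ω)) (D.mwRate w (D.S 0 ω))
      (D.X 0 ω) i : ℕ) : ℝ≥0∞) ≤ ∑ i, (w i : ℝ≥0∞) * ∑ j, (D.X 0 ω i j : ℝ≥0∞) := fun ω => by
    have : (∑ i, w i * offeredService (D.mwUser w (D.S 0 ω)) (D.mwRate w (D.S 0 ω))
      (D.X 0 ω) i : ℕ) ≤ ∑ i, w i * ∑ j, D.X 0 ω i j :=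
      Finset.sum_le_sum fun i _ => Nat.mul_le_mul_left _ (offeredService_le _ _ _ _)
    exact_mod_cast this
  refine ((lintegral_mono hle).trans_lt ?_).ne
  have hm : ∀ i j, Measurable fun ω => (D.X 0 ω i j : ℝ≥0∞) := fun i j =>
    (Measurable.of_discrete (f := fun n : ℕ => (n : ℝ≥0∞))).comp (D.measurable_channel 0 i j)
  rw [lintegral_finsetSum _ fun i _ => (Finset.measurable_sum _ fun j _ => hm i j).const_mul _]
  refine ENNReal.sum_lt_top.2 fun i _ => ?_
  rw [lintegral_const_mul _ (Finset.measurable_sum _ fun j _ => hm i j),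
    lintegral_finsetSum _ fun j _ => hm i j]
  exact ENNReal.mul_lt_top (by simp) (ENNReal.sum_lt_top.2 fun j _ =>
    (D.lintegral_channel_ne_top i j).lt_top)

theorem maxWeightedService_single (i : Fin N) :
    D.maxWeightedService (Pi.single i 1) = ENNReal.ofReal (D.userRate i) := by
  have hnn : ∀ s, 0 ≤ D.estProb s * ∑ j, D.bestGoodput s i j := fun s =>
    mul_nonneg (D.estProb_nonneg s) (Finset.sum_nonneg fun j _ => D.bestGoodput_nonneg _ _ _)
  -- Finiteness supplies summability, without which the real `tsum` in `userRate` would be 0 by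
  -- default.
  have h := D.maxWeightedService_ne_top (Pi.single i 1)
  simp only [maxWeightedService, maxWeightedGoodput_single] at h ⊢
  rw [userRate, ENNReal.ofReal_tsum_of_nonneg hnn]
  have := ENNReal.summable_toReal h
  refine this.congr fun s => ?_
  rw [ENNReal.toReal_ofReal (hnn s)]

theorem minUserRate_mul_sum_le (w : Fin N → ℕ) :
    ENNReal.ofReal D.minUserRate * ((∑ i, w i : ℕ) : ℝ≥0∞) ≤ N * D.maxWeightedService w := by
  calc _ = ∑ i, (w i : ℝ≥0∞) * ENNReal.ofReal D.minUserRate := by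
        push_cast; rw [Finset.mul_sum]; exact Finset.sum_congr rfl fun i _ => mul_comm _ _
    _ ≤ ∑ i, (w i : ℝ≥0∞) * D.maxWeightedService (Pi.single i 1) := by
        refine Finset.sum_le_sum fun i _ => ?_
        rw [maxWeightedService_single]
        gcongr
        exact Finset.inf'_le _ (Finset.mem_univ i)
    _ = ∑' s, ∑ i, (w i : ℝ≥0∞) * ENNReal.ofReal (D.estProb s * ∑ j, D.bestGoodput s i j) := by
        rw [Summable.tsum_finsetSum fun _ _ => ENNReal.summable]
        refine Finset.sum_congr rfl fun i _ => ?_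
        rw [ENNReal.tsum_mul_left]
        simp only [maxWeightedService, maxWeightedGoodput_single]
    _ ≤ ∑' s, (N : ℝ≥0∞) * ENNReal.ofReal (D.estProb s * D.maxWeightedGoodput w s) := by
        refine ENNReal.tsum_le_tsum fun s => ?_
        have hnn : ∀ i, 0 ≤ ∑ j, D.bestGoodput s i j := fun i =>
          Finset.sum_nonneg fun j _ => D.bestGoodput_nonneg _ _ _
        have e : ∀ i, (w i : ℝ≥0∞) * ENNReal.ofReal (D.estProb s * ∑ j, D.bestGoodput s i j)
            = ENNReal.ofReal (D.estProb s * (w i * ∑ j, D.bestGoodput s i j)) := fun i => by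
          rw [mul_left_comm (D.estProb s), ENNReal.ofReal_mul (Nat.cast_nonneg _),
            ENNReal.ofReal_natCast]
        simp_rw [e]
        rw [← ENNReal.ofReal_sum_of_nonneg fun i _ => mul_nonneg (D.estProb_nonneg s)
          (mul_nonneg (Nat.cast_nonneg _) (hnn i)), ← Finset.mul_sum]
        rw [← ENNReal.ofReal_natCast N, ← ENNReal.ofReal_mul (Nat.cast_nonneg _),
          mul_left_comm (N : ℝ)]
        exact ENNReal.ofReal_le_ofReal (mul_le_mul_of_nonneg_left
          (D.sum_mul_sum_bestGoodput_le w s) (D.estProb_nonneg s))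
    _ = _ := ENNReal.tsum_mul_left

/-- The rate vectors that satisfy the capacity constraints given by the MaxWeight service. -/
def outerRegion : Set (Fin N → ℝ) :=
  {l | (∀ i, 0 ≤ l i) ∧
    ∀ w : Fin N → ℕ, ∑ i, (w i : ℝ≥0∞) * ENNReal.ofReal (l i) ≤ D.maxWeightedService w}

theorem isClosed_outerRegion : IsClosed D.outerRegion := by
  have : D.outerRegion = (⋂ i, {l : Fin N → ℝ | 0 ≤ l i}) ∩ ⋂ w : Fin N → ℕ,
      {l : Fin N → ℝ | ∑ i, (w i : ℝ≥0∞) * ENNReal.ofReal (l i) ≤ D.maxWeightedService w} := by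
    ext l; simp [outerRegion]
  rw [this]
  refine (isClosed_iInter fun i => isClosed_le continuous_const (continuous_apply i)).inter
    (isClosed_iInter fun w => isClosed_le ?_ continuous_const)
  refine continuous_finsetSum _ fun i _ => ?_
  exact (ENNReal.continuous_const_mul (by simp)).comp
    (ENNReal.continuous_ofReal.comp (continuous_apply i))

/-- Given `s`, the constraints cut out a convex set containing the vertices, hence the hull;
averaging over `s` preserves linear inequalities. -/
theorem explicitRegion_subset_outerRegion : D.explicitRegion ⊆ D.outerRegion := by
  rintro l ⟨y, hy, hsum⟩
  have hhull : ∀ s, (∀ i, 0 ≤ y s i) ∧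
      ∀ w : Fin N → ℕ, ∑ i, w i * y s i ≤ D.maxWeightedGoodput w s := fun s => by
    have hconv : Convex ℝ {v : Fin N → ℝ | (∀ i, 0 ≤ v i) ∧
        ∀ w : Fin N → ℕ, ∑ i, w i * v i ≤ D.maxWeightedGoodput w s} := by
      rintro u ⟨hu1, hu2⟩ v ⟨hv1, hv2⟩ a b ha hb hab
      refine ⟨fun i => ?_, fun w => ?_⟩
      · exact add_nonneg (mul_nonneg ha (hu1 i)) (mul_nonneg hb (hv1 i))
      · calc ∑ i, w i * (a • u + b • v) i
            = a * ∑ i, w i * u i + b * ∑ i, w i * v i := by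
              simp only [Finset.mul_sum, ← Finset.sum_add_distrib]
              refine Finset.sum_congr rfl fun i _ => ?_
              simp; ring
          _ ≤ a * D.maxWeightedGoodput w s + b * D.maxWeightedGoodput w s := by
              gcongr
              exacts [hu2 w, hv2 w]
          _ = _ := by rw [← add_mul, hab, one_mul]
    refine convexHull_min ?_ hconv (hy s)
    rintro v (rfl | ⟨i, rfl⟩)
    · exact ⟨fun i => le_rfl, fun w => by simpa using D.maxWeightedGoodput_nonneg w s⟩
    · have hnn : 0 ≤ ∑ j, D.bestGoodput s i j :=
        Finset.sum_nonneg fun j _ => D.bestGoodput_nonneg _ _ _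
      refine ⟨fun k => ?_, fun w => ?_⟩
      · have : (0 : Fin N → ℝ) ≤ Pi.single i (∑ j, D.bestGoodput s i j) := Pi.single_nonneg.2 hnn
        exact this k
      · have : ∑ k, (w k : ℝ) * (Pi.single i (∑ j, D.bestGoodput s i j) : Fin N → ℝ) k
            = w i * ∑ j, D.bestGoodput s i j := by
          rw [Finset.sum_eq_single i]
          · simp
          · intro k _ hk; simp [Pi.single_eq_of_ne hk]
          · simp
        exact this.le.trans (D.mul_sum_bestGoodput_le w s i)
  have hcoord : ∀ i, HasSum (fun s => D.estProb s * y s i) (l i) := fun i =>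
    (Pi.hasSum.1 hsum) i
  have hl : ∀ i, 0 ≤ l i := fun i =>
    (hcoord i).nonneg fun s => mul_nonneg (D.estProb_nonneg s) ((hhull s).1 i)
  refine ⟨hl, fun w => ?_⟩
  have h1 : HasSum (fun s => D.estProb s * ∑ i, w i * y s i) (∑ i, w i * l i) := by
    have := hasSum_sum (s := Finset.univ) fun i _ => (hcoord i).mul_left (w i : ℝ)
    refine this.congr_fun fun s => ?_
    rw [Finset.mul_sum]
    exact Finset.sum_congr rfl fun i _ => by ring
  have h2 : ∑ i, (w i : ℝ≥0∞) * ENNReal.ofReal (l i) = ENNReal.ofReal (∑ i, w i * l i) := by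
    rw [ENNReal.ofReal_sum_of_nonneg fun i _ => mul_nonneg (Nat.cast_nonneg _) (hl i)]
    refine Finset.sum_congr rfl fun i _ => ?_
    rw [ENNReal.ofReal_mul (Nat.cast_nonneg _), ENNReal.ofReal_natCast]
  rw [h2, ← h1.tsum_eq, ENNReal.ofReal_tsum_of_nonneg _ h1.summable]
  · exact ENNReal.tsum_le_tsum fun s => ENNReal.ofReal_le_ofReal
      (mul_le_mul_of_nonneg_left ((hhull s).2 w) (D.estProb_nonneg s))
  · exact fun s => mul_nonneg (D.estProb_nonneg s) (Finset.sum_nonneg fun i _ =>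
      mul_nonneg (Nat.cast_nonneg _) ((hhull s).1 i))

end

end Downlink

/-! ### Means under probability mass functions. -/

section PMFMean

variable {α β : Type*}

/-- The mean of a nonnegative function under a probability mass function. -/
def pmfMean (p : PMF α) (g : α → ℝ≥0∞) : ℝ≥0∞ := ∑' a, p a * g a

theorem pmfMean_mono (p : PMF α) {g h : α → ℝ≥0∞} (hgh : ∀ a, g a ≤ h a) :
    pmfMean p g ≤ pmfMean p h :=
  ENNReal.tsum_le_tsum fun a => by gcongr; exact hgh a

theorem pmfMean_add (p : PMF α) (g h : α → ℝ≥0∞) :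
    pmfMean p (fun a => g a + h a) = pmfMean p g + pmfMean p h := by
  simp only [pmfMean, mul_add]
  exact ENNReal.tsum_add

theorem pmfMean_const (p : PMF α) (c : ℝ≥0∞) : pmfMean p (fun _ => c) = c := by
  rw [pmfMean, ENNReal.tsum_mul_right, p.tsum_coe, one_mul]

theorem pmfMean_const_mul (p : PMF α) (c : ℝ≥0∞) (g : α → ℝ≥0∞) :
    pmfMean p (fun a => c * g a) = c * pmfMean p g := by
  simp only [pmfMean, mul_left_comm]
  exact ENNReal.tsum_mul_left

theorem pmfMean_sum {ι : Type*} (p : PMF α) (s : Finset ι) (g : ι → α → ℝ≥0∞) :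
    pmfMean p (fun a => ∑ i ∈ s, g i a) = ∑ i ∈ s, pmfMean p (g i) := by
  simp only [pmfMean, Finset.mul_sum]
  exact Summable.tsum_finsetSum fun _ _ => ENNReal.summable

theorem pmfMean_bind (p : PMF α) (f : α → PMF β) (g : β → ℝ≥0∞) :
    pmfMean (p.bind f) g = pmfMean p fun a => pmfMean (f a) g := by
  simp only [pmfMean, PMF.bind_apply, ← ENNReal.tsum_mul_right, ← ENNReal.tsum_mul_left]
  rw [ENNReal.tsum_comm]
  simp only [mul_assoc]

theorem pmfMean_pure (a : α) (g : α → ℝ≥0∞) : pmfMean (PMF.pure a) g = g a := by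
  rw [pmfMean, tsum_eq_single a]
  · simp
  · intro b hb; simp [hb]

theorem pmfMean_map (p : PMF α) (f : α → β) (g : β → ℝ≥0∞) :
    pmfMean (p.map f) g = pmfMean p fun a => g (f a) := by
  rw [PMF.map, pmfMean_bind]
  simp only [Function.comp, pmfMean_pure]

end PMFMean

/-! ### Necessity: stabilizable rates satisfy the capacity constraints. -/

namespace Downlink

variable {N M : ℕ} [NeZero N] {σ : Type*} [MeasurableSpace σ] [Countable σ]
  [MeasurableSingletonClass σ]
  {Ω : Type*} [MeasurableSpace Ω] {P : Measure Ω} [IsProbabilityMeasure P]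
  (D : Downlink N M σ P)

theorem pmfMean_channelLaw (g : (Fin N → Fin M → ℕ) × (Fin N → Fin M → σ) → ℝ≥0∞) :
    pmfMean D.channelLaw g = ∫⁻ ω, g (D.X 0 ω, D.S 0 ω) ∂P := by
  have hm : Measurable fun ω => (D.X 0 ω, D.S 0 ω) := (D.measurable_X 0).prodMk (D.measurable_S 0)
  rw [← lintegral_map (f := g) .of_discrete hm, lintegral_countable']
  refine tsum_congr fun c => ?_
  rw [mul_comm]
  rfl

/-- Once `s` is fixed, the randomized decision does not see the channel states, so its mean is a
mixture of values for deterministic decisions, each bounded by the MaxWeight value. -/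
theorem pmfMean_service_le (w : Fin N → ℕ) (δ : (Fin N → Fin M → σ) → PMF (Fin M → Fin N × ℕ)) :
    pmfMean D.channelLaw (fun c => pmfMean (δ c.2) fun d =>
      ((∑ i, w i * offeredService (fun j => (d j).1) (fun j => (d j).2) c.1 i : ℕ) : ℝ≥0∞))
      ≤ D.maxWeightedService w := by
  rw [pmfMean_channelLaw, D.lintegral_eq_tsum_est]
  refine ENNReal.tsum_le_tsum fun s => ?_
  have hm : ∀ d : Fin M → Fin N × ℕ, Measurable fun ω =>
      ((∑ i, w i * offeredService (fun j => (d j).1) (fun j => (d j).2) (D.X 0 ω) i : ℕ) : ℝ≥0∞) :=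
    fun d => (Measurable.of_discrete (f := fun x : Fin N → Fin M → ℕ =>
      ((∑ i, w i * offeredService (fun j => (d j).1) (fun j => (d j).2) x i : ℕ) : ℝ≥0∞))).comp
        (D.measurable_X 0)
  calc _ = ∫⁻ ω in D.S 0 ⁻¹' {s}, ∑' d, δ s d *
        ((∑ i, w i * offeredService (fun j => (d j).1) (fun j => (d j).2) (D.X 0 ω) i : ℕ) : ℝ≥0∞)
        ∂P := by
        refine setLIntegral_congr_fun (D.measurableSet_est s) fun ω hω => ?_
        have : D.S 0 ω = s := hω
        simp only [this, pmfMean]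
    _ = ∑' d, δ s d * ∫⁻ ω in D.S 0 ⁻¹' {s},
        ((∑ i, w i * offeredService (fun j => (d j).1) (fun j => (d j).2) (D.X 0 ω) i : ℕ) : ℝ≥0∞)
        ∂P := by
        rw [lintegral_tsum fun d => ((hm d).const_mul _).aemeasurable]
        exact tsum_congr fun d => lintegral_const_mul _ (hm d)
    _ ≤ pmfMean (δ s) fun _ => ENNReal.ofReal (D.estProb s * D.maxWeightedGoodput w s) :=
        ENNReal.tsum_le_tsum fun d => by
          gcongr
          exact D.setLIntegral_service_le w _ _ s
    _ = _ := pmfMean_const _ _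

/-- The positive part can only lose service: q + a ≤ q' + μ coordinatewise. Keeping this additive
form avoids subtraction in `ℝ≥0∞`. -/
theorem mean_policyQueueLaw_succ
    (π : (Fin N → ℕ) → (Fin N → Fin M → σ) → PMF (Fin M → Fin N × ℕ)) (α : PMF (Fin N → ℕ))
    (w : Fin N → ℕ) (t : ℕ) :
    pmfMean (D.policyQueueLaw π α t) (fun q => ((∑ i, w i * q i : ℕ) : ℝ≥0∞))
        + pmfMean α (fun a => ((∑ i, w i * a i : ℕ) : ℝ≥0∞))
      ≤ pmfMean (D.policyQueueLaw π α (t + 1)) (fun q => ((∑ i, w i * q i : ℕ) : ℝ≥0∞))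
        + D.maxWeightedService w := by
  rw [policyQueueLaw, pmfMean_bind]
  conv_rhs => rw [← pmfMean_const (D.policyQueueLaw π α t) (D.maxWeightedService w)]
  conv_lhs => rw [← pmfMean_const (D.policyQueueLaw π α t)
    (pmfMean α fun a => ((∑ i, w i * a i : ℕ) : ℝ≥0∞))]
  rw [← pmfMean_add, ← pmfMean_add]
  refine pmfMean_mono _ fun q => ?_
  refine le_trans ?_ (add_le_add le_rfl (D.pmfMean_service_le w (π q)))
  rw [pmfMean_bind, ← pmfMean_add]
  set L := ((∑ i, w i * q i : ℕ) : ℝ≥0∞) + pmfMean α fun a => ((∑ i, w i * a i : ℕ) : ℝ≥0∞) with hL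
  rw [← pmfMean_const D.channelLaw L]
  refine pmfMean_mono _ fun c => ?_
  rw [pmfMean_bind, ← pmfMean_add, ← pmfMean_const (π q c.2) L]
  refine pmfMean_mono _ fun d => ?_
  rw [pmfMean_map, hL, ← pmfMean_const α ((∑ i, w i * q i : ℕ) : ℝ≥0∞),
    ← pmfMean_const α ((∑ i, w i * offeredService (fun j => (d j).1) (fun j => (d j).2) c.1 i : ℕ) :
      ℝ≥0∞), ← pmfMean_add, ← pmfMean_add]
  refine pmfMean_mono _ fun a => ?_
  have : ∑ i, w i * q i + ∑ i, w i * a i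
      ≤ ∑ i, w i * queueStep q (fun j => (d j).1) (fun j => (d j).2) c.1 a i
        + ∑ i, w i * offeredService (fun j => (d j).1) (fun j => (d j).2) c.1 i := by
    rw [← Finset.sum_add_distrib, ← Finset.sum_add_distrib]
    refine Finset.sum_le_sum fun i _ => ?_
    rw [← mul_add, ← mul_add]
    refine Nat.mul_le_mul_left _ ?_
    simp only [queueStep]
    omega
  exact_mod_cast this

theorem mean_policyQueueLaw_ge
    (π : (Fin N → ℕ) → (Fin N → Fin M → σ) → PMF (Fin M → Fin N × ℕ)) (α : PMF (Fin N → ℕ))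
    (w : Fin N → ℕ) (t : ℕ) :
    t * pmfMean α (fun a => ((∑ i, w i * a i : ℕ) : ℝ≥0∞))
      ≤ pmfMean (D.policyQueueLaw π α t) (fun q => ((∑ i, w i * q i : ℕ) : ℝ≥0∞))
        + t * D.maxWeightedService w := by
  induction t with
  | zero => simp
  | succ t ih =>
    rw [Nat.cast_succ, add_mul, add_mul, one_mul, one_mul]
    refine (add_le_add ih le_rfl).trans ?_
    have := D.mean_policyQueueLaw_succ π α w t
    calc _ = (pmfMean (D.policyQueueLaw π α t) (fun q => ((∑ i, w i * q i : ℕ) : ℝ≥0∞))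
          + pmfMean α (fun a => ((∑ i, w i * a i : ℕ) : ℝ≥0∞)))
          + t * D.maxWeightedService w := by ring
      _ ≤ _ := add_le_add this le_rfl
      _ = _ := by ring

/-- If w·l exceeded Ψ(w) by ε, then E[w·Q(t)] ≥ tε, so the time averages of the weighted backlog
would be unbounded, against strong stability. -/
theorem stablySupported_subset_outerRegion {l : Fin N → ℝ} (hl : D.StablySupported l) :
    l ∈ D.outerRegion := by
  obtain ⟨π, α, -, hmean, hstab⟩ := hl
  have hnn : ∀ i, 0 ≤ l i := fun i =>
    (hmean i).nonneg fun a => mul_nonneg ENNReal.toReal_nonneg (Nat.cast_nonneg _)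
  refine ⟨hnn, fun w => ?_⟩
  have hα : pmfMean α (fun a => ((∑ i, w i * a i : ℕ) : ℝ≥0∞))
      = ∑ i, (w i : ℝ≥0∞) * ENNReal.ofReal (l i) := by
    push_cast
    rw [pmfMean_sum]
    refine Finset.sum_congr rfl fun i _ => ?_
    rw [pmfMean_const_mul, ← (hmean i).tsum_eq, ENNReal.ofReal_tsum_of_nonneg
      (fun a => mul_nonneg ENNReal.toReal_nonneg (Nat.cast_nonneg _)) (hmean i).summable, pmfMean]
    congr 1
    refine tsum_congr fun a => ?_
    rw [ENNReal.ofReal_mul ENNReal.toReal_nonneg, ENNReal.ofReal_natCast,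
      ENNReal.ofReal_toReal (α.apply_ne_top a)]
  rw [← hα]
  set L := pmfMean α (fun a => ((∑ i, w i * a i : ℕ) : ℝ≥0∞)) with hL
  set m : ℕ → ℝ≥0∞ := fun t =>
    pmfMean (D.policyQueueLaw π α t) (fun q => ((∑ i, w i * q i : ℕ) : ℝ≥0∞)) with hm
  by_contra! hlt
  set ε := L - D.maxWeightedService w with hε
  have hε0 : ε ≠ 0 := (tsub_pos_of_lt hlt).ne'
  have hlow : ∀ t : ℕ, t * ε ≤ m t := fun t => by
    rw [hε, ENNReal.mul_sub fun _ _ => by simp]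
    exact tsub_le_iff_right.2 (D.mean_policyQueueLaw_ge π α w t)
  have hsum : ∀ t, ∑ τ ∈ Finset.range t, m τ
      = ∑ i, (w i : ℝ≥0∞) * ∑ τ ∈ Finset.range t, ∑' q, D.policyQueueLaw π α τ q * (q i : ℝ≥0∞) := by
    intro t
    simp only [Finset.mul_sum]
    rw [Finset.sum_comm]
    refine Finset.sum_congr rfl fun τ _ => ?_
    simp only [hm]
    push_cast
    rw [pmfMean_sum]
    exact Finset.sum_congr rfl fun i _ => pmfMean_const_mul _ _ _
  choose C hC1 hC2 using fun i => exists_between (hstab i)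
  have hev : ∀ᶠ t : ℕ in atTop, ∀ i, (∑ τ ∈ Finset.range t,
      ∑' q, D.policyQueueLaw π α τ q * (q i : ℝ≥0∞)) / (t : ℝ≥0∞) < C i :=
    eventually_all.2 fun i => eventually_lt_of_limsup_lt (hC1 i)
  set B := ∑ i, (w i : ℝ≥0∞) * C i with hB
  have hBtop : B ≠ ⊤ := ENNReal.sum_ne_top.2 fun i _ => ENNReal.mul_ne_top (by simp) (hC2 i).ne
  have hup : ∀ᶠ t : ℕ in atTop, ∑ τ ∈ Finset.range t, m τ ≤ t * B := by
    filter_upwards [hev, eventually_gt_atTop 0] with t ht h0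
    rw [hsum, hB, Finset.mul_sum]
    refine Finset.sum_le_sum fun i _ => ?_
    rw [mul_left_comm]
    gcongr
    have := (ENNReal.div_lt_iff (Or.inl (by exact_mod_cast h0.ne')) (Or.inl (by simp))).1 (ht i)
    rw [mul_comm]
    exact this.le
  obtain ⟨n₀, hn₀⟩ := ENNReal.exists_nat_mul_gt hε0 (b := 2 * B)
    (ENNReal.mul_ne_top (by simp) hBtop)
  obtain ⟨t₀, ht₀⟩ := eventually_atTop.1 hup
  set n := max n₀ t₀ + 1 with hn
  -- In the second half of `2n` slots each mean is at least `nε`, so the sum is at least `n²ε`;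
  -- stability caps it at `2nB`, which fails for large `n`.
  have h1 : (n : ℝ≥0∞) * (n * ε) ≤ ∑ τ ∈ Finset.range (n + n), m τ := by
    rw [Finset.sum_range_add]
    refine le_trans ?_ le_add_self
    calc (n : ℝ≥0∞) * (n * ε) = ∑ _τ ∈ Finset.range n, (n : ℝ≥0∞) * ε := by simp
      _ ≤ _ := Finset.sum_le_sum fun τ _ => le_trans (by gcongr; omega) (hlow (n + τ))
  have h2 := ht₀ (n + n) (by omega)
  have h3 : (n : ℝ≥0∞) * (n * ε) ≤ n * (2 * B) := h1.trans (h2.trans_eq (by push_cast; ring))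
  have h4 : (n : ℝ≥0∞) * ε ≤ 2 * B :=
    (ENNReal.mul_le_mul_iff_right (by simp [hn]) (by simp)).1 h3
  refine absurd (hn₀.trans_le (le_trans ?_ h4)) (lt_irrefl _)
  gcongr
  omega

theorem stabilityRegion_subset_outerRegion : D.stabilityRegion ⊆ D.outerRegion :=
  closure_minimal (fun _ hl => D.stablySupported_subset_outerRegion hl) D.isClosed_outerRegion

end Downlink

/-! ### Monotonicity and linearity of cycle means. -/

section CycleMeanAlgebra

variable {S Ξ : Type*} [MeasurableSpace Ξ] [Countable Ξ] [MeasurableSingletonClass Ξ]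
  [MeasurableSpace S] [Countable S] [MeasurableSingletonClass S]
  (F : S → Ξ → S) (ν : Measure Ξ) [IsProbabilityMeasure ν]

theorem tabooMean_mono {z : S} {g g' : S → Ξ → ℝ≥0∞}
    (h : ∀ q, ∫⁻ a, g q a ∂ν ≤ ∫⁻ a, g' q a ∂ν) (t : ℕ) (q : S) :
    tabooMean F ν z g t q ≤ tabooMean F ν z g' t q := by
  induction t generalizing q with
  | zero => rw [tabooMean_zero, tabooMean_zero]; exact h q
  | succ t ih =>
    rw [tabooMean_succ, tabooMean_succ]
    exact lintegral_mono fun a => indicator_le_indicator (ih (F q a))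

/-- The mean reward of a cycle is monotone in the conditional mean rewards given the state. -/
theorem cycleMean_mono {z : S} {g g' : S → Ξ → ℝ≥0∞}
    (h : ∀ q, ∫⁻ a, g q a ∂ν ≤ ∫⁻ a, g' q a ∂ν) (q : S) :
    cycleMean F ν z g q ≤ cycleMean F ν z g' q :=
  ENNReal.tsum_le_tsum fun t => tabooMean_mono F ν h t q

theorem cycleMean_add (z : S) (g g' : S → Ξ → ℝ≥0∞) (q : S) :
    cycleMean F ν z (fun q a => g q a + g' q a) q
      = cycleMean F ν z g q + cycleMean F ν z g' q := by
  rw [cycleMean_eq_lintegral, cycleMean_eq_lintegral, cycleMean_eq_lintegral, ← lintegral_add_left]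
  · refine lintegral_congr fun x => ?_
    rw [← ENNReal.tsum_add]
    refine tsum_congr fun t => ?_
    by_cases h : x ∈ {x | ∀ k < t, traj F q x (k + 1) ≠ z}
    · rw [indicator_of_mem h, indicator_of_mem h, indicator_of_mem h]
    · rw [indicator_of_notMem h, indicator_of_notMem h, indicator_of_notMem h, add_zero]
  · exact Measurable.tsum fun t => (measurable_traj_reward F g q t).indicator
      (measurableSet_avoid F z q t)

theorem cycleMean_const_mul (z : S) (c : ℝ≥0∞) (g : S → Ξ → ℝ≥0∞) (q : S) :
    cycleMean F ν z (fun q a => c * g q a) q = c * cycleMean F ν z g q := by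
  simp only [cycleMean, ← ENNReal.tsum_mul_left]
  refine tsum_congr fun t => ?_
  rw [tabooMean, tabooMean, ← lintegral_const_mul _ ((measurable_traj_reward F g q t).indicator
    (measurableSet_avoid F z q t))]
  refine lintegral_congr fun x => ?_
  by_cases h : x ∈ {x | ∀ k < t, traj F q x (k + 1) ≠ z}
  · rw [indicator_of_mem h, indicator_of_mem h]
  · rw [indicator_of_notMem h, indicator_of_notMem h, mul_zero]

theorem cycleMean_const (z : S) (c : ℝ≥0∞) (q : S) :
    cycleMean F ν z (fun _ _ => c) q = c * cycleMean F ν z (fun _ _ => 1) q := by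
  simpa using cycleMean_const_mul F ν z c (fun _ _ => 1) q

end CycleMeanAlgebra

/-! ### Quadratic Lyapunov drift of MaxWeight, and second moments of the service. -/

theorem queueStep_sq_le {N M : ℕ} (q : Fin N → ℕ) (I : Fin M → Fin N) (R : Fin M → ℕ)
    (x : Fin N → Fin M → ℕ) (a : Fin N → ℕ) :
    ∑ i, queueStep q I R x a i ^ 2 + 2 * ∑ i, q i * offeredService I R x i
      ≤ ∑ i, q i ^ 2 + (∑ i, a i ^ 2 + ∑ i, offeredService I R x i ^ 2)
        + 2 * ∑ i, q i * a i := by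
  simp only [Finset.mul_sum, ← Finset.sum_add_distrib]
  refine Finset.sum_le_sum fun i _ => ?_
  simp only [queueStep]
  generalize offeredService I R x i = m
  -- If m ≤ q, expanding the square leaves −2ma, which is dropped; hence dependence between arrivals
  -- and channels within a slot is harmless. If m > q, the term 2qm is absorbed by q² + m².
  rcases le_total m (q i) with h | h
  · obtain ⟨d, hd⟩ := Nat.exists_eq_add_of_le h
    rw [hd, Nat.add_sub_cancel_left]
    nlinarith [Nat.zero_le (m * a i), Nat.zero_le (d * a i)]
  · rw [Nat.sub_eq_zero_of_le h]
    have h1 : 2 * (q i * m) ≤ q i ^ 2 + m ^ 2 := by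
      zify; nlinarith [sq_nonneg ((q i : ℤ) - m)]
    nlinarith [Nat.zero_le (q i * a i)]

namespace Downlink

section
variable {N M : ℕ} [NeZero N] {σ : Type*} [MeasurableSpace σ] {Ω : Type*} [MeasurableSpace Ω]
  {P : Measure Ω} (D : Downlink N M σ P)

/-- The arrivals, the channel states and the channel estimates of a slot. -/
abbrev Slot (N M : ℕ) (σ : Type*) : Type _ :=
  (Fin N → ℕ) × (Fin N → Fin M → ℕ) × (Fin N → Fin M → σ)

/-- The random data of slot `t`. -/
def slot (t : ℕ) (ω : Ω) : Slot N M σ := (D.A t ω, D.X t ω, D.S t ω)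

/-- The queue lengths after a slot under MaxWeight. -/
def mwStep (q : Fin N → ℕ) (a : Slot N M σ) : Fin N → ℕ :=
  queueStep q (D.mwUser q a.2.2) (D.mwRate q a.2.2) a.2.1 a.1

/-- The service offered in a slot under MaxWeight. -/
def mwService (q : Fin N → ℕ) (a : Slot N M σ) (i : Fin N) : ℕ :=
  offeredService (D.mwUser q a.2.2) (D.mwRate q a.2.2) a.2.1 i

/-- The law of the random data of a slot. -/
def slotLaw : Measure (Slot N M σ) := P.map (D.slot 0)

theorem Q_eq_traj (t : ℕ) (ω : Ω) :
    D.Q t ω = traj D.mwStep (D.Q0 ω) (fun t => D.slot t ω) t := by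
  induction t with
  | zero => rfl
  | succ t ih => rw [traj, ← ih]; rfl

theorem service_eq (t : ℕ) (ω : Ω) (i : Fin N) :
    D.service t ω i = D.mwService (D.Q t ω) (D.slot t ω) i := rfl

theorem service_le (t : ℕ) (ω : Ω) (i : Fin N) : D.service t ω i ≤ ∑ j, D.X t ω i j :=
  offeredService_le _ _ _ _

theorem measurable_slot (t : ℕ) : Measurable (D.slot t) :=
  (D.measurable_A t).prodMk ((D.measurable_X t).prodMk (D.measurable_S t))

variable [Countable σ] [MeasurableSingletonClass σ] [IsProbabilityMeasure P]

instance : IsProbabilityMeasure D.slotLaw :=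
  Measure.isProbabilityMeasure_map (D.measurable_slot 0).aemeasurable

theorem lintegral_slotLaw (h : Slot N M σ → ℝ≥0∞) :
    ∫⁻ a, h a ∂D.slotLaw = ∫⁻ ω, h (D.slot 0 ω) ∂P :=
  lintegral_map .of_discrete (D.measurable_slot 0)

theorem map_slots : P.map (fun ω t => D.slot t ω) = iidLaw D.slotLaw := by
  have h := iIndepFun.map_fun_eq_infinitePi_map D.measurable_slot D.indep
  rw [h]
  have : (fun t => P.map (D.slot t)) = fun _ => D.slotLaw :=
    funext fun t => (D.identDistrib t).map_eq
  simp only [this]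

theorem measurable_slots : Measurable fun ω t => D.slot t ω :=
  measurable_pi_iff.2 D.measurable_slot

theorem slotLaw_apply (s : Set (Slot N M σ)) : D.slotLaw s = P {ω | D.slot 0 ω ∈ s} :=
  Measure.map_apply (D.measurable_slot 0) .of_discrete

theorem transition_iff (q q' : Fin N → ℕ) :
    D.Transition q q' ↔ 0 < D.slotLaw {a | D.mwStep q a = q'} := by
  rw [slotLaw_apply]; rfl

theorem ae_mwStep_mem {E : Set (Fin N → ℕ)}
    (hE : ∀ q ∈ E, ∀ q', D.Transition q q' → q' ∈ E) {q : Fin N → ℕ} (hq : q ∈ E) :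
    ∀ᵐ a ∂D.slotLaw, D.mwStep q a ∈ E := by
  rw [ae_iff]
  have : {a | D.mwStep q a ∉ E} = ⋃ q' ∈ Eᶜ, {a | D.mwStep q a = q'} := by
    ext a; simp
  rw [this, measure_biUnion_null_iff (to_countable _)]
  intro q' hq'
  by_contra h
  exact hq' (hE q hq q' ((D.transition_iff q q').2 (pos_iff_ne_zero.2 h)))

theorem ofReal_rate (i : Fin N) : ∫⁻ ω, (D.A 0 ω i : ℝ≥0∞) ∂P = ENNReal.ofReal (D.rate i) := by
  rw [rate, ofReal_integral_eq_lintegral_ofReal ((D.memLp_A i).integrable one_le_two)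
    (Eventually.of_forall fun ω => Nat.cast_nonneg _)]
  simp

theorem ofReal_arrivalSq (i : Fin N) :
    ∫⁻ ω, (D.A 0 ω i : ℝ≥0∞) ^ 2 ∂P = ENNReal.ofReal (D.arrivalSq i) := by
  rw [arrivalSq, ofReal_integral_eq_lintegral_ofReal (D.memLp_A i).integrable_sq
    (Eventually.of_forall fun ω => sq_nonneg _)]
  refine lintegral_congr fun ω => ?_
  rw [ENNReal.ofReal_pow (Nat.cast_nonneg _), ENNReal.ofReal_natCast]

theorem arrivalSq_nonneg (i : Fin N) : 0 ≤ D.arrivalSq i := integral_nonneg fun _ => sq_nonneg _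

theorem lintegral_mwStep_sq_le (q : Fin N → ℕ) :
    ∫⁻ a, ((∑ i, D.mwStep q a i ^ 2 : ℕ) : ℝ≥0∞) ∂D.slotLaw + 2 * D.maxWeightedService q
      ≤ ((∑ i, q i ^ 2 : ℕ) : ℝ≥0∞) + (ENNReal.ofReal (∑ i, D.arrivalSq i)
        + ∫⁻ a, ((∑ i, D.mwService q a i ^ 2 : ℕ) : ℝ≥0∞) ∂D.slotLaw)
        + 2 * ∑ i, (q i : ℝ≥0∞) * ENNReal.ofReal (D.rate i) := by
  have h1 : D.maxWeightedService q
      = ∫⁻ a, ((∑ i, q i * D.mwService q a i : ℕ) : ℝ≥0∞) ∂D.slotLaw := by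
    rw [← lintegral_maxWeight_service, lintegral_slotLaw]; rfl
  have h2 : ∑ i, (q i : ℝ≥0∞) * ENNReal.ofReal (D.rate i)
      = ∫⁻ a, ((∑ i, q i * a.1 i : ℕ) : ℝ≥0∞) ∂D.slotLaw := by
    push_cast
    rw [lintegral_finsetSum _ fun _ _ => .of_discrete]
    refine Finset.sum_congr rfl fun i _ => ?_
    rw [lintegral_const_mul _ .of_discrete, lintegral_slotLaw, ← ofReal_rate]; rfl
  have h3 : ENNReal.ofReal (∑ i, D.arrivalSq i)
      = ∫⁻ a, ((∑ i, a.1 i ^ 2 : ℕ) : ℝ≥0∞) ∂D.slotLaw := by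
    push_cast
    rw [lintegral_finsetSum _ fun _ _ => .of_discrete,
      ENNReal.ofReal_sum_of_nonneg fun i _ => D.arrivalSq_nonneg i]
    refine Finset.sum_congr rfl fun i _ => ?_
    rw [lintegral_slotLaw, ← ofReal_arrivalSq]; rfl
  have h4 : ((∑ i, q i ^ 2 : ℕ) : ℝ≥0∞) = ∫⁻ _, ((∑ i, q i ^ 2 : ℕ) : ℝ≥0∞) ∂D.slotLaw := by simp
  rw [h1, h2, h3, h4, ← lintegral_const_mul _ .of_discrete, ← lintegral_const_mul _ .of_discrete,
    ← lintegral_add_left .of_discrete, ← lintegral_add_left .of_discrete,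
    ← lintegral_add_left .of_discrete, ← lintegral_add_left .of_discrete]
  refine lintegral_mono fun a => ?_
  have h : ∑ i, D.mwStep q a i ^ 2 + 2 * ∑ i, q i * D.mwService q a i
      ≤ ∑ i, q i ^ 2 + (∑ i, a.1 i ^ 2 + ∑ i, D.mwService q a i ^ 2) + 2 * ∑ i, q i * a.1 i :=
    queueStep_sq_le q (D.mwUser q a.2.2) (D.mwRate q a.2.2) a.2.1 a.1
  simpa only [Nat.cast_add, Nat.cast_mul, Nat.cast_ofNat] using (Nat.cast_le (α := ℝ≥0∞)).2 h

/-- The Lyapunov drift of MaxWeight inside the capacity region. -/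
theorem mw_drift {ρ : ℝ} (h0 : 0 ≤ ρ) (h1 : ρ ≤ 1) (hρ : D.rate ∈ ρ • D.outerRegion)
    (q : Fin N → ℕ) :
    ∫⁻ a, ((∑ i, D.mwStep q a i ^ 2 : ℕ) : ℝ≥0∞) ∂D.slotLaw
        + 2 * (ENNReal.ofReal ((1 - ρ) * D.minUserRate / N) * ((∑ i, q i : ℕ) : ℝ≥0∞))
      ≤ ((∑ i, q i ^ 2 : ℕ) : ℝ≥0∞) + (ENNReal.ofReal (∑ i, D.arrivalSq i)
        + ∫⁻ a, ((∑ i, D.mwService q a i ^ 2 : ℕ) : ℝ≥0∞) ∂D.slotLaw) := by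
  obtain ⟨l, ⟨hl, hlw⟩, hrate⟩ := hρ
  have hΨ := D.maxWeightedService_ne_top q
  have e1 : ∑ i, (q i : ℝ≥0∞) * ENNReal.ofReal (D.rate i)
      ≤ ENNReal.ofReal ρ * D.maxWeightedService q := by
    refine le_trans (le_of_eq ?_) (mul_le_mul_right (hlw q) _)
    rw [Finset.mul_sum]
    refine Finset.sum_congr rfl fun i _ => ?_
    rw [← hrate]
    simp only [Pi.smul_apply, smul_eq_mul]
    rw [ENNReal.ofReal_mul h0, mul_left_comm]
  have e2 : ENNReal.ofReal ((1 - ρ) * D.minUserRate / N) * ((∑ i, q i : ℕ) : ℝ≥0∞)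
      ≤ ENNReal.ofReal (1 - ρ) * D.maxWeightedService q := by
    have hN : (0 : ℝ) < N := by exact_mod_cast NeZero.pos N
    rw [mul_div_assoc, ENNReal.ofReal_mul (sub_nonneg.2 h1), mul_assoc]
    gcongr
    rw [ENNReal.ofReal_div_of_pos hN, ENNReal.ofReal_natCast, ENNReal.div_eq_inv_mul, mul_assoc]
    have hNe : (N : ℝ≥0∞) ≠ 0 := by exact_mod_cast NeZero.ne N
    calc (N : ℝ≥0∞)⁻¹ * (ENNReal.ofReal D.minUserRate * ((∑ i, q i : ℕ) : ℝ≥0∞))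
        ≤ (N : ℝ≥0∞)⁻¹ * (N * D.maxWeightedService q) :=
          mul_le_mul_right (D.minUserRate_mul_sum_le q) _
      _ = _ := ENNReal.inv_mul_cancel_left' (fun h => absurd h hNe) (by simp)
  have e3 : D.maxWeightedService q = ENNReal.ofReal ρ * D.maxWeightedService q
      + ENNReal.ofReal (1 - ρ) * D.maxWeightedService q := by
    rw [← add_mul, ← ENNReal.ofReal_add h0 (sub_nonneg.2 h1)]; simp
  -- Of the gain 2Ψ(q), the share 2ρΨ(q) cancels the arrival term and the share 2(1−ρ)Ψ(q) yields
  -- the negative drift. The cancellation is legitimate because Ψ(q) is finite.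
  refine (add_le_add le_rfl (mul_le_mul_right e2 2)).trans ?_
  refine (ENNReal.add_le_add_iff_right
    (a := 2 * (ENNReal.ofReal ρ * D.maxWeightedService q)) (by finiteness)).1 ?_
  calc _ = ∫⁻ a, ((∑ i, D.mwStep q a i ^ 2 : ℕ) : ℝ≥0∞) ∂D.slotLaw
        + 2 * (ENNReal.ofReal ρ * D.maxWeightedService q
          + ENNReal.ofReal (1 - ρ) * D.maxWeightedService q) := by ring
    _ = ∫⁻ a, ((∑ i, D.mwStep q a i ^ 2 : ℕ) : ℝ≥0∞) ∂D.slotLaw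
        + 2 * D.maxWeightedService q := by rw [← e3]
    _ ≤ _ := (D.lintegral_mwStep_sq_le q).trans (by gcongr)

theorem memLp_sum_channel (t : ℕ) (i : Fin N) :
    MemLp (fun ω => ((∑ j, D.X t ω i j : ℕ) : ℝ)) 2 P := by
  have h0 : MemLp (fun ω => ((∑ j, D.X 0 ω i j : ℕ) : ℝ)) 2 P := by
    have := memLp_finsetSum (μ := P) (p := 2) Finset.univ fun j _ => D.memLp_X i j
    refine this.congr_norm ?_ ?_
    · exact ((Measurable.of_discrete (f := fun a : Slot N M σ => ((∑ j, a.2.1 i j : ℕ) : ℝ))).comp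
        (D.measurable_slot 0)).aestronglyMeasurable
    · exact Eventually.of_forall fun ω => by simp
  have hid : IdentDistrib (fun ω => ((∑ j, D.X t ω i j : ℕ) : ℝ))
      (fun ω => ((∑ j, D.X 0 ω i j : ℕ) : ℝ)) P P :=
    (D.identDistrib t).comp (u := fun a : Slot N M σ => ((∑ j, a.2.1 i j : ℕ) : ℝ)) .of_discrete
  exact hid.memLp_iff.2 h0

theorem integral_sum_channel_sq (t : ℕ) (i : Fin N) :
    ∫ ω, ((∑ j, D.X t ω i j : ℕ) : ℝ) ^ 2 ∂P = ∫ ω, ((∑ j, D.X 0 ω i j : ℕ) : ℝ) ^ 2 ∂P :=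
  ((D.identDistrib t).comp (u := fun a : Slot N M σ => ((∑ j, a.2.1 i j : ℕ) : ℝ) ^ 2)
    .of_discrete).integral_eq

theorem measurable_Q (t : ℕ) : Measurable (D.Q t) := by
  induction t with
  | zero => exact D.measurable_Q0
  | succ t ih =>
    have : D.Q (t + 1) = fun ω => D.mwStep (D.Q t ω) (D.slot t ω) := rfl
    rw [this]
    exact (Measurable.of_discrete (f := fun p : (Fin N → ℕ) × Slot N M σ => D.mwStep p.1 p.2)).comp
      (ih.prodMk (D.measurable_slot t))

theorem measurable_service (t : ℕ) (i : Fin N) : Measurable fun ω => D.service t ω i := by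
  have h : Measurable fun p : (Fin N → ℕ) × Slot N M σ => D.mwService p.1 p.2 i := .of_discrete
  have h2 : Measurable fun ω => (D.Q t ω, D.slot t ω) :=
    (D.measurable_Q t).prodMk (D.measurable_slot t)
  have h3 : (fun ω => D.service t ω i)
      = (fun p : (Fin N → ℕ) × Slot N M σ => D.mwService p.1 p.2 i)
        ∘ fun ω => (D.Q t ω, D.slot t ω) := funext fun ω => D.service_eq t ω i
  rw [h3]
  exact h.comp h2

theorem integrable_service_sq (t : ℕ) (i : Fin N) :
    Integrable (fun ω => (D.service t ω i : ℝ) ^ 2) P := by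
  refine (D.memLp_sum_channel t i).integrable_sq.mono' ?_ ?_
  · exact (((Measurable.of_discrete (f := fun n : ℕ => (n : ℝ))).comp
      (D.measurable_service t i)).pow_const 2).aestronglyMeasurable
  · refine Eventually.of_forall fun ω => ?_
    rw [Real.norm_of_nonneg (sq_nonneg _)]
    have : (D.service t ω i : ℝ) ≤ ((∑ j, D.X t ω i j : ℕ) : ℝ) := by
      exact_mod_cast D.service_le t ω i
    gcongr

theorem integral_service_sq_le (t : ℕ) (i : Fin N) :
    ∫ ω, (D.service t ω i : ℝ) ^ 2 ∂P ≤ ∫ ω, ((∑ j, D.X 0 ω i j : ℕ) : ℝ) ^ 2 ∂P := by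
  rw [← D.integral_sum_channel_sq t i]
  refine integral_mono (D.integrable_service_sq t i) (D.memLp_sum_channel t i).integrable_sq ?_
  intro ω
  have : (D.service t ω i : ℝ) ≤ ((∑ j, D.X t ω i j : ℕ) : ℝ) := by
    exact_mod_cast D.service_le t ω i
  simp only
  gcongr

theorem lintegral_mwService_sq_le (q : Fin N → ℕ) :
    ∫⁻ a, ((∑ i, D.mwService q a i ^ 2 : ℕ) : ℝ≥0∞) ∂D.slotLaw
      ≤ ENNReal.ofReal (∑ i, ∫ ω, ((∑ j, D.X 0 ω i j : ℕ) : ℝ) ^ 2 ∂P) := by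
  rw [lintegral_slotLaw, ← integral_finsetSum _ fun i _ => (D.memLp_sum_channel 0 i).integrable_sq,
    ofReal_integral_eq_lintegral_ofReal
      (integrable_finsetSum _ fun i _ => (D.memLp_sum_channel 0 i).integrable_sq)
      (Eventually.of_forall fun ω => Finset.sum_nonneg fun i _ => sq_nonneg _)]
  refine lintegral_mono fun ω => ?_
  have h : (∑ i, D.mwService q (D.slot 0 ω) i ^ 2 : ℕ) ≤ ∑ i, (∑ j, D.X 0 ω i j) ^ 2 :=
    Finset.sum_le_sum fun i _ => Nat.pow_le_pow_left (offeredService_le _ _ _ _) 2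
  calc _ ≤ ((∑ i, (∑ j, D.X 0 ω i j) ^ 2 : ℕ) : ℝ≥0∞) := by exact_mod_cast h
    _ = ENNReal.ofReal ((∑ i, (∑ j, D.X 0 ω i j) ^ 2 : ℕ) : ℝ) := (ENNReal.ofReal_natCast _).symm
    _ = _ := by push_cast; rfl

end

end Downlink

/-! ### Almost sure limits of backlog and squared service. -/

namespace Downlink

variable {N M : ℕ} [NeZero N] {σ : Type*} [MeasurableSpace σ] [Countable σ]
  [MeasurableSingletonClass σ] {Ω : Type*} [MeasurableSpace Ω]
  {P : Measure Ω} [IsProbabilityMeasure P] (D : Downlink N M σ P)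

/-- The long-run averages of the backlog and of the squared service exist under MaxWeight, and they
satisfy the drift inequality. -/
theorem exists_average_limits (hirr : D.Irreducible) (hμ : 0 < D.minUserRate) {ρ₀ : ℝ}
    (h0 : 0 ≤ ρ₀) (h1 : ρ₀ < 1) (hρ₀ : D.rate ∈ ρ₀ • D.outerRegion) :
    ∃ f s : ℝ, 0 ≤ f ∧ 0 ≤ s ∧
      (∀ᵐ ω ∂P, Tendsto (fun T : ℕ =>
        ((∑ t ∈ Finset.range T, ∑ i, D.Q t ω i : ℕ) : ℝ) / T) atTop (𝓝 f)) ∧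
      (∀ᵐ ω ∂P, Tendsto (fun T : ℕ =>
        ((∑ t ∈ Finset.range T, ∑ i, D.service t ω i ^ 2 : ℕ) : ℝ) / T) atTop (𝓝 s)) ∧
      ∀ ρ : ℝ, 0 ≤ ρ → ρ ≤ 1 → D.rate ∈ ρ • D.outerRegion →
        2 * ((1 - ρ) * D.minUserRate / N * f) ≤ ∑ i, D.arrivalSq i + s := by
  obtain ⟨E, hQ0, hEcl, hEirr⟩ := hirr
  obtain ⟨ω₀, hω₀⟩ := hQ0.exists
  set z := D.Q0 ω₀ with hz
  have hN : (0 : ℝ) < N := by exact_mod_cast NeZero.pos N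
  have hE : ∀ q ∈ E, ∀ᵐ a ∂D.slotLaw, D.mwStep q a ∈ E := fun q hq => D.ae_mwStep_mem hEcl hq
  have hirr' : ∀ q ∈ E, Relation.ReflTransGen
      (fun q q' => 0 < D.slotLaw {a | D.mwStep q a = q'}) q z := fun q hq => by
    simp only [← transition_iff]
    exact hEirr q hq z hω₀
  set V : (Fin N → ℕ) → ℝ≥0∞ := fun q => ((∑ i, q i ^ 2 : ℕ) : ℝ≥0∞) with hV
  set a₂ : ℝ := ∑ i, D.arrivalSq i with ha₂
  have ha₂nn : 0 ≤ a₂ := Finset.sum_nonneg fun i _ => D.arrivalSq_nonneg i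
  set B : ℝ := ∑ i, ∫ ω, ((∑ j, D.X 0 ω i j : ℕ) : ℝ) ^ 2 ∂P with hB
  have hBnn : 0 ≤ B := Finset.sum_nonneg fun i _ => integral_nonneg fun _ => sq_nonneg _
  set c : ℝ≥0 := ((1 - ρ₀) * D.minUserRate / N).toNNReal with hc
  have hcpos : 0 < c := Real.toNNReal_pos.2 (by
    have := sub_pos.2 h1
    positivity)
  have hfin : ∀ n, {q : Fin N → ℕ | ∑ i, q i ≤ n}.Finite := fun n => by
    refine (Set.Finite.pi' fun _ : Fin N => finite_Iic n).subset fun q hq i => ?_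
    exact (Finset.single_le_sum (f := q) (fun _ _ => Nat.zero_le _) (Finset.mem_univ i)).trans hq
  -- The reference load `ρ₀` serves only to prove finiteness; the limits do not depend on it, so the
  -- final inequality can be asserted for every admissible `ρ`.
  have hfoster : ∀ q ∈ E, cycleMean D.mwStep D.slotLaw z
      (fun q _ => 1 + c * ((∑ i, q i : ℕ) : ℝ≥0∞)) q ≠ ⊤ := fun q hq => by
    refine cycleMean_ne_top_of_drift D.mwStep D.slotLaw hE hirr' V (fun q => by simp [hV])
      (fun q => ∑ i, q i) hfin hcpos (b := (a₂ + B).toNNReal) (fun q _ => ?_) hq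
    refine (D.mw_drift h0 h1.le hρ₀ q).trans (add_le_add le_rfl ?_)
    change _ ≤ ENNReal.ofReal (a₂ + B)
    rw [ENNReal.ofReal_add ha₂nn hBnn]
    exact add_le_add le_rfl (D.lintegral_mwService_sq_le q)
  have hone : ∀ q ∈ E, cycleMean D.mwStep D.slotLaw z (fun _ _ => 1) q ≠ ⊤ := fun q hq =>
    ne_top_of_le_ne_top (hfoster q hq) (cycleMean_mono _ _ (fun q => lintegral_mono fun a =>
      le_self_add) q)
  have hτ := hone z hω₀
  set m := cycleMean D.mwStep D.slotLaw z (fun _ _ => 1) z with hm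
  have hmpos : 0 < m.toReal :=
    ENNReal.toReal_pos (one_pos.trans_le (one_le_cycleMean_one _ _ z z)).ne' hτ
  set Jf := cycleMean D.mwStep D.slotLaw z (fun q _ => ((∑ i, q i : ℕ) : ℝ≥0∞)) z with hJf
  set Js := cycleMean D.mwStep D.slotLaw z
    (fun q a => ((∑ i, D.mwService q a i ^ 2 : ℕ) : ℝ≥0∞)) z with hJs
  have hJf_top : Jf ≠ ⊤ := by
    intro htop
    refine hfoster z hω₀ ?_
    rw [cycleMean_add, cycleMean_const_mul, ← hJf, htop, ENNReal.mul_top (by simpa using hcpos.ne')]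
    simp
  have hJs_top : Js ≠ ⊤ := by
    have h2 : Js ≤ cycleMean D.mwStep D.slotLaw z (fun _ _ => ENNReal.ofReal B) z :=
      cycleMean_mono _ _ (fun q => by
        rw [lintegral_const, measure_univ, mul_one]
        exact D.lintegral_mwService_sq_le q) z
    rw [cycleMean_const] at h2
    exact ne_top_of_le_ne_top (ENNReal.mul_ne_top (by simp) hτ) h2
  have transfer : ∀ (r : (Fin N → ℕ) → Slot N M σ → ℕ),
      cycleMean D.mwStep D.slotLaw z (fun q a => (r q a : ℝ≥0∞)) z ≠ ⊤ →
      ∀ᵐ ω ∂P, Tendsto (fun T : ℕ =>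
        ((∑ t ∈ Finset.range T, r (D.Q t ω) (D.slot t ω) : ℕ) : ℝ) / T) atTop
        (𝓝 ((cycleMean D.mwStep D.slotLaw z (fun q a => (r q a : ℝ≥0∞)) z).toReal / m.toReal)) := by
    intro r hr
    -- `E` is countable, so one null set works for all initial states and the random `Q0` may be
    -- substituted afterwards.
    have h2 : ∀ᵐ x ∂iidLaw D.slotLaw, ∀ q ∈ E, Tendsto (fun n : ℕ =>
        ((∑ t ∈ Finset.range n, r (traj D.mwStep q x t) (x t) : ℕ) : ℝ) / n) atTop
        (𝓝 ((cycleMean D.mwStep D.slotLaw z (fun q a => (r q a : ℝ≥0∞)) z).toReal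
          / m.toReal)) :=
      (ae_ball_iff (to_countable E)).2 fun q hq =>
        ae_tendsto_average D.mwStep D.slotLaw hτ (hone q hq) r hr
    rw [← D.map_slots] at h2
    filter_upwards [ae_of_ae_map D.measurable_slots.aemeasurable h2, hQ0] with ω hω hq
    refine (hω _ hq).congr fun T => ?_
    simp only [D.Q_eq_traj]
  refine ⟨Jf.toReal / m.toReal, Js.toReal / m.toReal, by positivity, by positivity,
    transfer (fun q _ => ∑ i, q i) hJf_top, transfer (fun q a => ∑ i, D.mwService q a i ^ 2) hJs_top,
    fun ρ hρ0 hρ1 hρ => ?_⟩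
  have hκ : 0 ≤ (1 - ρ) * D.minUserRate / N := by
    have := sub_nonneg.2 hρ1
    positivity
  -- The squared service stays as a reward on the right instead of being replaced by the crude bound
  -- `B`; its average `s` will be bounded through `K`.
  have h3 := cycleMean_le_cycleMean_of_drift D.mwStep D.slotLaw hE hω₀ hτ V (by simp [hV])
    (fun q _ => (2 * ENNReal.ofReal ((1 - ρ) * D.minUserRate / N)) * ((∑ i, q i : ℕ) : ℝ≥0∞))
    (fun q a => ENNReal.ofReal a₂ + ((∑ i, D.mwService q a i ^ 2 : ℕ) : ℝ≥0∞))
    (fun q _ => by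
      rw [lintegral_const, measure_univ, mul_one, lintegral_add_left measurable_const,
        lintegral_const, measure_univ, mul_one, mul_assoc]
      exact D.mw_drift hρ0 hρ1 hρ q)
  rw [cycleMean_const_mul, cycleMean_add, cycleMean_const, ← hJf, ← hJs, ← hm] at h3
  have h4 := ENNReal.toReal_mono (by finiteness) h3
  rw [ENNReal.toReal_add (by finiteness) hJs_top, ENNReal.toReal_mul, ENNReal.toReal_mul,
    ENNReal.toReal_mul, ENNReal.toReal_ofReal hκ, ENNReal.toReal_ofReal ha₂nn] at h4
  rw [← mul_div_assoc, ← mul_div_assoc, div_le_iff₀ hmpos, add_mul, div_mul_cancel₀ _ hmpos.ne',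
    ← mul_assoc]
  simpa using h4

/-- The long-run average of the squared service is at most the bound for its mean. -/
theorem average_service_sq_le {s C : ℝ} (hC : 0 ≤ C)
    (hs : ∀ᵐ ω ∂P, Tendsto (fun T : ℕ =>
      ((∑ t ∈ Finset.range T, ∑ i, D.service t ω i ^ 2 : ℕ) : ℝ) / T) atTop (𝓝 s))
    (hb : ∀ t, ∑ i, ∫ ω, (D.service t ω i : ℝ) ^ 2 ∂P ≤ C) : s ≤ C := by
  have hmN : ∀ T, Measurable fun ω => ∑ t ∈ Finset.range T, ∑ i, D.service t ω i ^ 2 := fun T =>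
    Finset.measurable_sum _ fun t _ => Finset.measurable_sum _ fun i _ =>
      (Measurable.of_discrete (f := fun n : ℕ => n ^ 2)).comp (D.measurable_service t i)
  have hm : ∀ T : ℕ, Measurable fun ω =>
      ENNReal.ofReal (((∑ t ∈ Finset.range T, ∑ i, D.service t ω i ^ 2 : ℕ) : ℝ) / T) := fun T =>
    (Measurable.of_discrete (f := fun n : ℕ => ENNReal.ofReal ((n : ℝ) / T))).comp (hmN T)
  have hle : ∀ T : ℕ, ∫⁻ ω,
      ENNReal.ofReal (((∑ t ∈ Finset.range T, ∑ i, D.service t ω i ^ 2 : ℕ) : ℝ) / T) ∂P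
        ≤ ENNReal.ofReal C := fun T => by
    have hint : Integrable (fun ω =>
        ((∑ t ∈ Finset.range T, ∑ i, D.service t ω i ^ 2 : ℕ) : ℝ) / T) P := by
      push_cast
      exact (integrable_finsetSum _ fun t _ => integrable_finsetSum _ fun i _ =>
        D.integrable_service_sq t i).div_const _
    rw [← ofReal_integral_eq_lintegral_ofReal hint (Eventually.of_forall fun ω => by positivity)]
    refine ENNReal.ofReal_le_ofReal ?_
    push_cast
    rw [integral_div, integral_finsetSum _ fun t _ => integrable_finsetSum _ fun i _ =>
      D.integrable_service_sq t i]
    refine div_le_of_le_mul₀ (by positivity) hC ?_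
    refine (Finset.sum_le_card_nsmul _ _ C fun t _ => ?_).trans ?_
    · rw [integral_finsetSum _ fun i _ => D.integrable_service_sq t i]
      exact hb t
    · simp [mul_comm]
  have hlim : ∀ᵐ ω ∂P, liminf (fun T : ℕ =>
      ENNReal.ofReal (((∑ t ∈ Finset.range T, ∑ i, D.service t ω i ^ 2 : ℕ) : ℝ) / T)) atTop
        = ENNReal.ofReal s := by
    filter_upwards [hs] with ω hω
    exact (ENNReal.tendsto_ofReal hω).liminf_eq
  -- Fatou's lemma: the limit is a constant, and the mean of each time average is at most `C`. No
  -- convergence of means is needed.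
  have h1 : ENNReal.ofReal s ≤ ENNReal.ofReal C := by
    calc ENNReal.ofReal s = ∫⁻ _, ENNReal.ofReal s ∂P := by simp
      _ = _ := (lintegral_congr_ae hlim).symm
      _ ≤ _ := lintegral_liminf_le hm
      _ ≤ liminf (fun _ : ℕ => ENNReal.ofReal C) atTop :=
        liminf_le_liminf (Eventually.of_forall hle)
      _ = _ := liminf_const _
  exact (ENNReal.ofReal_le_ofReal_iff hC).1 h1

end Downlink

/-! ### Packet delays and Little's law. -/

namespace Downlink

section Delay

variable {N M : ℕ} [NeZero N] {σ : Type*} [MeasurableSpace σ] {Ω : Type*} [MeasurableSpace Ω]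
  {P : Measure Ω} (D : Downlink N M σ P) (ω : Ω) (i : Fin N)

theorem departed_add_Q (t : ℕ) : D.departed t ω i + D.Q t ω i = D.entered t ω i := by
  induction t with
  | zero => simp [departed, entered, Q]
  | succ t ih =>
    have hQ : D.Q (t + 1) ω i = (D.Q t ω i - D.service t ω i) + D.A t ω i := rfl
    have h1 : D.departed (t + 1) ω i = D.departed t ω i + min (D.Q t ω i) (D.service t ω i) := by
      simp [departed, Finset.sum_range_succ]
    have h2 : D.entered (t + 1) ω i = D.entered t ω i + D.A t ω i := by
      simp [entered, Finset.sum_range_succ, add_assoc]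
    rw [hQ, h1, h2, ← ih]
    omega

theorem departed_mono : Monotone fun t => D.departed t ω i := fun _ _ h =>
  Finset.sum_le_sum_of_subset (Finset.range_mono h)

theorem entered_mono : Monotone fun t => D.entered t ω i := fun _ _ h =>
  Nat.add_le_add_left (Finset.sum_le_sum_of_subset (Finset.range_mono h)) _

/-- Double counting of pairs (packet, slot at whose beginning it is queued). All packets concerned
have left by `T'`, so only slots before `T'` contribute, each at most its backlog. -/
theorem sum_packetDelay_le {T T' : ℕ} (h : D.entered T ω i ≤ D.departed T' ω i) :
    ∑ n ∈ Finset.Ico (D.Q0 ω i) (D.entered T ω i), (D.packetDelay ω i n : ℝ≥0∞)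
      ≤ ((∑ t ∈ Finset.range T', D.Q t ω i : ℕ) : ℝ≥0∞) := by
  have h1 : ∀ n ∈ Finset.Ico (D.Q0 ω i) (D.entered T ω i), (D.packetDelay ω i n : ℝ≥0∞)
      ≤ ((∑ t ∈ Finset.range T',
        if D.departed t ω i ≤ n ∧ n < D.entered t ω i then 1 else 0 : ℕ) : ℝ≥0∞) := by
    intro n hn
    rw [← Finset.card_filter]
    have h2 : {t : ℕ | D.departed t ω i ≤ n ∧ n < D.entered t ω i} ⊆
        ((Finset.range T').filter fun t => D.departed t ω i ≤ n ∧ n < D.entered t ω i :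
          Finset ℕ) := by
      intro t ht
      have h3 : D.departed t ω i ≤ n ∧ n < D.entered t ω i := ht
      rw [Finset.mem_coe, Finset.mem_filter, Finset.mem_range]
      refine ⟨?_, h3⟩
      by_contra! hlt
      have h4 := D.departed_mono ω i hlt
      have h5 := (Finset.mem_Ico.1 hn).2
      simp only at h4
      omega
    have h3 := Set.encard_le_encard h2
    rw [Set.encard_coe_eq_coe_finsetCard] at h3
    rw [packetDelay]
    exact_mod_cast h3
  refine (Finset.sum_le_sum h1).trans ?_
  rw [← Nat.cast_sum, Finset.sum_comm]
  refine Nat.cast_le.2 (Finset.sum_le_sum fun t _ => ?_)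
  rw [← Finset.card_filter]
  have h6 : (Finset.Ico (D.Q0 ω i) (D.entered T ω i)).filter
      (fun n => D.departed t ω i ≤ n ∧ n < D.entered t ω i)
        ⊆ Finset.Ico (D.departed t ω i) (D.entered t ω i) := by
    intro n hn
    rw [Finset.mem_Ico]
    exact (Finset.mem_filter.1 hn).2
  refine (Finset.card_le_card h6).trans ?_
  rw [Nat.card_Ico, ← D.departed_add_Q ω i t]
  omega

/-- The same count from below. The backlog also contains initial packets, which are not among those
averaged; they number at most `Q0` and are gone by `t₀`. -/
theorem le_sum_packetDelay {t₀ : ℕ} (h : D.Q0 ω i ≤ D.departed t₀ ω i) (T : ℕ) :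
    ((∑ t ∈ Finset.range T, D.Q t ω i : ℕ) : ℝ≥0∞)
      ≤ ∑ n ∈ Finset.Ico (D.Q0 ω i) (D.entered T ω i), (D.packetDelay ω i n : ℝ≥0∞)
        + ((t₀ * D.Q0 ω i : ℕ) : ℝ≥0∞) := by
  have h1 : ∀ n, ((∑ t ∈ Finset.range T,
        if D.departed t ω i ≤ n ∧ n < D.entered t ω i then 1 else 0 : ℕ) : ℝ≥0∞)
      ≤ (D.packetDelay ω i n : ℝ≥0∞) := by
    intro n
    rw [← Finset.card_filter]
    have h2 : (((Finset.range T).filter fun t => D.departed t ω i ≤ n ∧ n < D.entered t ω i :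
          Finset ℕ) : Set ℕ) ⊆ {t : ℕ | D.departed t ω i ≤ n ∧ n < D.entered t ω i} := by
      intro t ht
      exact (Finset.mem_filter.1 (Finset.mem_coe.1 ht)).2
    have h3 := Set.encard_le_encard h2
    rw [Set.encard_coe_eq_coe_finsetCard] at h3
    rw [packetDelay]
    exact_mod_cast h3
  refine le_trans ?_ (add_le_add (Finset.sum_le_sum fun n _ => h1 n) le_rfl)
  rw [← Nat.cast_sum, Finset.sum_comm, ← Nat.cast_add]
  refine Nat.cast_le.2 ?_
  have h4 : ∀ t ∈ Finset.range T, D.Q t ω i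
      ≤ (∑ n ∈ Finset.Ico (D.Q0 ω i) (D.entered T ω i),
        if D.departed t ω i ≤ n ∧ n < D.entered t ω i then 1 else 0)
        + if t < t₀ then D.Q0 ω i else 0 := by
    intro t ht
    rw [← Finset.card_filter]
    have h5 : Finset.Ico (max (D.Q0 ω i) (D.departed t ω i)) (D.entered t ω i)
        ⊆ (Finset.Ico (D.Q0 ω i) (D.entered T ω i)).filter
          (fun n => D.departed t ω i ≤ n ∧ n < D.entered t ω i) := by
      intro n hn
      have h6 := D.entered_mono ω i (Finset.mem_range.1 ht).le
      simp only at h6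
      simp only [Finset.mem_Ico, Finset.mem_filter, max_le_iff] at hn ⊢
      omega
    have h7 := Finset.card_le_card h5
    rw [Nat.card_Ico, ← D.departed_add_Q ω i t] at h7
    split_ifs with h8
    · have := le_max_left (D.Q0 ω i) (D.departed t ω i)
      rw [← D.departed_add_Q ω i t]
      omega
    · have h9 := D.departed_mono ω i (not_lt.1 h8)
      simp only at h9
      rw [← D.departed_add_Q ω i t]
      omega
  refine (Finset.sum_le_sum h4).trans ?_
  rw [Finset.sum_add_distrib]
  refine Nat.add_le_add_left ?_ _
  rw [← Finset.sum_filter, Finset.sum_const, smul_eq_mul]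
  refine Nat.mul_le_mul_right _ ?_
  have h10 : (Finset.range T).filter (fun t => t < t₀) ⊆ Finset.range t₀ := by
    intro t ht
    exact Finset.mem_range.2 (Finset.mem_filter.1 ht).2
  simpa using Finset.card_le_card h10

/-- Little's law on a sample path. -/
theorem tendsto_averageDelay {f : ℝ} {l : Fin N → ℝ} (hl : ∀ i, 0 < l i)
    (hf : Tendsto (fun T : ℕ => ((∑ t ∈ Finset.range T, ∑ i, D.Q t ω i : ℕ) : ℝ) / T) atTop
      (𝓝 f))
    (hA : ∀ i, Tendsto (fun T : ℕ => ((∑ t ∈ Finset.range T, D.A t ω i : ℕ) : ℝ) / T) atTop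
      (𝓝 (l i))) :
    Tendsto (fun T => D.averageDelay T ω) atTop (𝓝 (ENNReal.ofReal (f / ∑ i, l i))) := by
  set G : ℕ → ℕ := fun T => ∑ t ∈ Finset.range T, ∑ i, D.Q t ω i with hG
  have hinv : Tendsto (fun T : ℕ => 1 / (T : ℝ)) atTop (𝓝 0) := tendsto_one_div_atTop_nhds_zero_nat
  -- A convergent average G(T)/T has increments of size o(T), so Q(T)/T → 0 and departures inherit
  -- the arrival rate.
  have hQ : ∀ i, Tendsto (fun T : ℕ => (D.Q T ω i : ℝ) / T) atTop (𝓝 0) := fun i => by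
    have h1 : Tendsto (fun T : ℕ => (G (T + 1) : ℝ) / ((T + 1 : ℕ) : ℝ) * (1 + 1 / (T : ℝ))
        - (G T : ℝ) / T) atTop (𝓝 (f * (1 + 0) - f)) :=
      ((hf.comp (tendsto_add_atTop_nat 1)).mul (tendsto_const_nhds.add hinv)).sub hf
    rw [add_zero, mul_one, sub_self] at h1
    refine squeeze_zero' (Eventually.of_forall fun T => by positivity) ?_ h1
    filter_upwards [eventually_gt_atTop 0] with T hT
    have hT' : (0 : ℝ) < T := by exact_mod_cast hT
    have h2 : (G (T + 1) : ℝ) = G T + ∑ i, (D.Q T ω i : ℝ) := by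
      simp [hG, Finset.sum_range_succ]
    have h3 : (D.Q T ω i : ℝ) ≤ ∑ i, (D.Q T ω i : ℝ) :=
      Finset.single_le_sum (f := fun i => (D.Q T ω i : ℝ)) (fun _ _ => Nat.cast_nonneg _)
        (Finset.mem_univ i)
    have h4 : (G (T + 1) : ℝ) / ((T + 1 : ℕ) : ℝ) * (1 + 1 / (T : ℝ)) - (G T : ℝ) / T
        = (∑ i, (D.Q T ω i : ℝ)) / T := by
      rw [h2]
      push_cast
      field_simp
      ring
    rw [h4]
    gcongr
  have hent : ∀ i, Tendsto (fun T : ℕ => (D.entered T ω i : ℝ) / T) atTop (𝓝 (l i)) := fun i => by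
    have h1 := ((tendsto_const_nhds (x := (D.Q0 ω i : ℝ))).mul hinv).add (hA i)
    rw [mul_zero, zero_add] at h1
    refine h1.congr fun T => ?_
    simp only [entered]
    push_cast
    ring
  have hdep : ∀ i, Tendsto (fun T : ℕ => (D.departed T ω i : ℝ) / T) atTop (𝓝 (l i)) := fun i => by
    have h1 := (hent i).sub (hQ i)
    rw [sub_zero] at h1
    refine h1.congr fun T => ?_
    rw [← D.departed_add_Q ω i T]
    push_cast
    ring
  -- As `l i > 0`, departures by time (1+ε)T are about (1+ε) `l i` T, strictly more than the entries
  -- by time T.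
  have hcatch : ∀ ε : ℝ, 0 < ε → ∀ᶠ T : ℕ in atTop, ∀ i,
      D.entered T ω i ≤ D.departed ⌊(1 + ε) * T⌋₊ ω i := fun ε hε => by
    refine eventually_all.2 fun i => ?_
    have hfl := tendsto_nat_floor_mul_div_atTop (R := ℝ) (a := 1 + ε) (by positivity)
    have hfl' : Tendsto (fun T : ℕ => (⌊(1 + ε) * T⌋₊ : ℝ) / T) atTop (𝓝 (1 + ε)) :=
      hfl.comp tendsto_natCast_atTop_atTop
    have hfloor : Tendsto (fun T : ℕ => ⌊(1 + ε) * (T : ℝ)⌋₊) atTop atTop :=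
      tendsto_nat_floor_atTop.comp
        (tendsto_natCast_atTop_atTop.const_mul_atTop (by positivity))
    have h1 := ((hdep i).comp hfloor).mul hfl'
    have h2 : l i < l i * (1 + ε) := by nlinarith [hl i]
    filter_upwards [(hent i).eventually_lt h1 h2, eventually_gt_atTop 0] with T hT h0
    have hT' : (0 : ℝ) < T := by exact_mod_cast h0
    have hfpos : 0 < ⌊(1 + ε) * (T : ℝ)⌋₊ := by
      refine Nat.floor_pos.2 ?_
      have : (1 : ℝ) ≤ T := by exact_mod_cast h0
      nlinarith
    have hfne : ((⌊(1 + ε) * (T : ℝ)⌋₊ : ℕ) : ℝ) ≠ 0 := by positivity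
    have h3 : (D.entered T ω i : ℝ) / T < (D.departed ⌊(1 + ε) * (T : ℝ)⌋₊ ω i : ℝ) / T := by
      refine hT.trans_eq ?_
      simp only [Function.comp]
      field_simp
    exact_mod_cast ((div_lt_div_iff_of_pos_right hT').1 h3).le
  set W : ℕ → ℝ≥0∞ := fun T => ∑ i, ∑ n ∈ Finset.Ico (D.Q0 ω i) (D.entered T ω i),
    (D.packetDelay ω i n : ℝ≥0∞) with hW
  have hWle : ∀ T T', (∀ i, D.entered T ω i ≤ D.departed T' ω i) → W T ≤ (G T' : ℝ≥0∞) := by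
    intro T T' h
    refine (Finset.sum_le_sum fun i _ => D.sum_packetDelay_le ω i (h i)).trans_eq ?_
    rw [← Nat.cast_sum, hG, Finset.sum_comm]
  have hdepinf : ∀ i, Tendsto (fun T => D.departed T ω i) atTop atTop := fun i => by
    have h1 : Tendsto (fun T : ℕ => (D.departed T ω i : ℝ) / T * T) atTop atTop :=
      (hdep i).pos_mul_atTop (hl i) tendsto_natCast_atTop_atTop
    have h2 : Tendsto (fun T : ℕ => (D.departed T ω i : ℝ)) atTop atTop := by
      refine h1.congr' ?_
      filter_upwards [eventually_gt_atTop 0] with T hT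
      have hT' : (T : ℝ) ≠ 0 := by positivity
      field_simp
    exact tendsto_natCast_atTop_iff.1 h2
  obtain ⟨t₀, ht₀⟩ := (eventually_all.2 fun i => (hdepinf i).eventually_ge_atTop (D.Q0 ω i)).exists
  set C : ℕ := ∑ i, t₀ * D.Q0 ω i with hC
  have hleW : ∀ T, (G T : ℝ≥0∞) ≤ W T + C := by
    intro T
    have h1 := Finset.sum_le_sum fun i (_ : i ∈ Finset.univ) =>
      D.le_sum_packetDelay ω i (ht₀ i) T
    rw [Finset.sum_add_distrib, ← Nat.cast_sum, ← Nat.cast_sum, Finset.sum_comm] at h1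
    exact h1
  have hWtop : ∀ T, W T ≠ ⊤ := fun T => by
    obtain ⟨T', hT'⟩ :=
      (eventually_all.2 fun i => (hdepinf i).eventually_ge_atTop (D.entered T ω i)).exists
    exact ne_top_of_le_ne_top (by simp) (hWle T T' hT')
  have hWlim : Tendsto (fun T : ℕ => (W T).toReal / T) atTop (𝓝 f) := by
    -- The total delay W(T) lies between G(T) − C and, eventually, G(⌊(1+ε)T⌋); dividing by T and
    -- letting ε → 0 pins the limit at f.
    refine tendsto_order.2 ⟨fun a ha => ?_, fun b hb => ?_⟩
    · have h1 := hf.sub ((tendsto_const_nhds (x := (C : ℝ))).mul hinv)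
      rw [mul_zero, sub_zero] at h1
      filter_upwards [h1.eventually_const_lt ha, eventually_gt_atTop 0] with T hT h0
      have hT' : (0 : ℝ) < T := by exact_mod_cast h0
      refine hT.trans_le ?_
      have h2 := ENNReal.toReal_mono (by finiteness [hWtop T]) (hleW T)
      rw [ENNReal.toReal_add (hWtop T) (by simp), ENNReal.toReal_natCast,
        ENNReal.toReal_natCast] at h2
      rw [mul_one_div, ← sub_div]
      gcongr
      linarith
    · obtain ⟨ε, hε, hεb⟩ : ∃ ε : ℝ, 0 < ε ∧ f * (1 + ε) < b := by
        have hcont : Tendsto (fun ε : ℝ => f * (1 + ε)) (𝓝[>] 0) (𝓝 (f * (1 + 0))) :=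
          ((continuous_const.mul (continuous_const.add continuous_id)).tendsto 0).mono_left
            nhdsWithin_le_nhds
        rw [add_zero, mul_one] at hcont
        obtain ⟨ε, h1, h2⟩ := ((hcont.eventually_lt_const hb).and self_mem_nhdsWithin).exists
        exact ⟨ε, h2, h1⟩
      have hfl := tendsto_nat_floor_mul_div_atTop (R := ℝ) (a := 1 + ε) (by positivity)
      have hfl' : Tendsto (fun T : ℕ => (⌊(1 + ε) * T⌋₊ : ℝ) / T) atTop (𝓝 (1 + ε)) :=
        hfl.comp tendsto_natCast_atTop_atTop
      have hfloor : Tendsto (fun T : ℕ => ⌊(1 + ε) * (T : ℝ)⌋₊) atTop atTop :=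
        tendsto_nat_floor_atTop.comp
          (tendsto_natCast_atTop_atTop.const_mul_atTop (by positivity))
      have h1 := (hf.comp hfloor).mul hfl'
      filter_upwards [h1.eventually_lt_const hεb, hcatch ε hε, eventually_gt_atTop 0]
        with T hT hT2 h0
      have hT' : (0 : ℝ) < T := by exact_mod_cast h0
      have hfpos : 0 < ⌊(1 + ε) * (T : ℝ)⌋₊ := by
        refine Nat.floor_pos.2 ?_
        have : (1 : ℝ) ≤ T := by exact_mod_cast h0
        nlinarith
      have hfne : ((⌊(1 + ε) * (T : ℝ)⌋₊ : ℕ) : ℝ) ≠ 0 := by positivity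
      refine lt_of_le_of_lt ?_ hT
      have h2 := ENNReal.toReal_mono (by simp) (hWle T _ hT2)
      rw [ENNReal.toReal_natCast] at h2
      calc (W T).toReal / T ≤ (G ⌊(1 + ε) * (T : ℝ)⌋₊ : ℝ) / T := by gcongr
        _ = _ := by
          simp only [Function.comp, hG]
          field_simp
  have hcount : Tendsto (fun T : ℕ => ((∑ i, ∑ τ ∈ Finset.range T, D.A τ ω i : ℕ) : ℝ) / T) atTop
      (𝓝 (∑ i, l i)) := by
    refine (tendsto_finsetSum Finset.univ fun i _ => hA i).congr fun T => ?_
    push_cast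
    rw [Finset.sum_div]
  have hsum : 0 < ∑ i, l i := Finset.sum_pos (fun i _ => hl i) Finset.univ_nonempty
  have hfinal := ENNReal.tendsto_ofReal (hWlim.div hcount hsum.ne')
  refine hfinal.congr' ?_
  filter_upwards [hcount.eventually_const_lt hsum, eventually_gt_atTop 0] with T hT h0
  have hT' : (0 : ℝ) < T := by exact_mod_cast h0
  have hpos : (0 : ℝ) < ((∑ i, ∑ τ ∈ Finset.range T, D.A τ ω i : ℕ) : ℝ) := by
    have := mul_pos hT hT'
    rwa [div_mul_cancel₀ _ hT'.ne'] at this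
  simp only [Pi.div_apply]
  rw [div_div_div_cancel_right₀ hT'.ne', ENNReal.ofReal_div_of_pos hpos,
    ENNReal.ofReal_toReal (hWtop T), ENNReal.ofReal_natCast]
  rfl

end Delay

theorem ae_tendsto_arrivals {N M : ℕ} {σ : Type*} [MeasurableSpace σ]
    {Ω : Type*} [MeasurableSpace Ω] {P : Measure Ω} [IsProbabilityMeasure P]
    (D : Downlink N M σ P) (i : Fin N) :
    ∀ᵐ ω ∂P, Tendsto (fun T : ℕ => ((∑ t ∈ Finset.range T, D.A t ω i : ℕ) : ℝ) / T) atTop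
      (𝓝 (D.rate i)) := by
  have hm : Measurable fun a : (Fin N → ℕ) × (Fin N → Fin M → ℕ) × (Fin N → Fin M → σ) =>
      (a.1 i : ℝ) :=
    (Measurable.of_discrete (f := fun a : Fin N → ℕ => (a i : ℝ))).comp measurable_fst
  have h := strong_law_ae_real (μ := P) (fun t ω => (D.A t ω i : ℝ))
    ((D.memLp_A i).integrable one_le_two)
    (fun s t hst => (D.indep.indepFun hst).comp hm hm)
    (fun t => (D.identDistrib t).comp hm)
  filter_upwards [h] with ω hω
  refine hω.congr fun T => ?_
  push_cast
  rfl

end Downlink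

/-! ### Consequences of interiority, and the theorem. -/

/-- An interior point of a set of nonnegative vectors has positive coordinates. -/
theorem pos_of_mem_interior {ι : Type*} [Finite ι] {s : Set (ι → ℝ)}
    (hs : ∀ l ∈ s, ∀ i, 0 ≤ l i) {l : ι → ℝ} (hl : l ∈ interior s) (i : ι) : 0 < l i := by
  classical
  have hcont : Continuous fun ε : ℝ => l - ε • (Pi.single i 1 : ι → ℝ) := by fun_prop
  have h0 : (fun ε : ℝ => l - ε • (Pi.single i 1 : ι → ℝ)) ⁻¹' interior s ∈ 𝓝 (0 : ℝ) :=
    (isOpen_interior.preimage hcont).mem_nhds (by simpa using hl)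
  have h1 : ∀ᶠ ε in 𝓝[>] (0 : ℝ), l - ε • (Pi.single i 1 : ι → ℝ) ∈ interior s :=
    nhdsWithin_le_nhds h0
  obtain ⟨ε, hε, hpos⟩ := (h1.and self_mem_nhdsWithin).exists
  have h2 := hs _ (interior_subset hε) i
  simp only [Pi.sub_apply, Pi.smul_apply, Pi.single_eq_same, smul_eq_mul, mul_one] at h2
  exact (show (0 : ℝ) < ε from hpos).trans_le (by linarith)

/-- An interior point of a set is a proper multiple of a point of the set. -/
theorem exists_mem_smul_of_mem_interior {E : Type*} [AddCommGroup E] [Module ℝ E]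
    [TopologicalSpace E] [ContinuousSMul ℝ E] {s : Set E} {l : E} (hl : l ∈ interior s) :
    ∃ ρ : ℝ, 0 < ρ ∧ ρ < 1 ∧ l ∈ ρ • s := by
  have hcont : Continuous fun c : ℝ => c • l := by fun_prop
  have h0 : (fun c : ℝ => c • l) ⁻¹' interior s ∈ 𝓝 (1 : ℝ) :=
    (isOpen_interior.preimage hcont).mem_nhds (by simpa using hl)
  have h1 : ∀ᶠ c in 𝓝[>] (1 : ℝ), c • l ∈ interior s := nhdsWithin_le_nhds h0
  obtain ⟨c, hc, hgt⟩ := (h1.and self_mem_nhdsWithin).exists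
  have hgt' : (1 : ℝ) < c := hgt
  have hpos : 0 < c := one_pos.trans hgt'
  refine ⟨c⁻¹, inv_pos.2 hpos, inv_lt_one_of_one_lt₀ hgt', c • l, interior_subset hc, ?_⟩
  simp [smul_smul, inv_mul_cancel₀ hpos.ne']

namespace Downlink

variable {N M : ℕ} {σ : Type*} [MeasurableSpace σ] {Ω : Type*} [MeasurableSpace Ω]
  {P : Measure Ω} [IsProbabilityMeasure P] (D : Downlink N M σ P)

theorem arrivalSq_pos {i : Fin N} (h : 0 < D.rate i) : 0 < D.arrivalSq i := by
  refine (integral_pos_iff_support_of_nonneg (fun _ => sq_nonneg _)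
    (D.memLp_A i).integrable_sq).2 ?_
  have h1 := (integral_pos_iff_support_of_nonneg (fun _ => Nat.cast_nonneg _)
    ((D.memLp_A i).integrable one_le_two)).1 h
  convert h1 using 2
  ext ω
  simp

variable [NeZero N] [Countable σ] [MeasurableSingletonClass σ]

theorem rate_le_userRate {l : Fin N → ℝ} (hl : l ∈ D.outerRegion) {i : Fin N} (hi : 0 < l i) :
    l i ≤ D.userRate i := by
  have h := hl.2 (Pi.single i 1)
  rw [maxWeightedService_single, Finset.sum_eq_single i] at h
  · simp only [Pi.single_eq_same, Nat.cast_one, one_mul] at h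
    exact (ENNReal.ofReal_le_ofReal_iff'.1 h).resolve_right hi.not_ge
  · intro k _ hk; simp [Pi.single_eq_of_ne hk]
  · simp

/-- The service is at most the sum of the channel states, whose second moment does not depend on the
slot. Adding 1 to that moment makes the inequality strict. -/
theorem exists_service_sq_lt (h : ∀ i, 0 < D.arrivalSq i) :
    ∃ K : ℝ, ∀ t i, ∫ ω, (D.service t ω i : ℝ) ^ 2 ∂P < K * D.arrivalSq i := by
  set B : Fin N → ℝ := fun i => ∫ ω, ((∑ j, D.X 0 ω i j : ℕ) : ℝ) ^ 2 ∂P with hB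
  have hBnn : ∀ i, 0 ≤ B i := fun i => integral_nonneg fun _ => sq_nonneg _
  refine ⟨∑ i, (B i + 1) / D.arrivalSq i, fun t i => ?_⟩
  have h1 : (B i + 1) / D.arrivalSq i ≤ ∑ i, (B i + 1) / D.arrivalSq i :=
    Finset.single_le_sum (f := fun i => (B i + 1) / D.arrivalSq i)
      (fun k _ => div_nonneg (by linarith [hBnn k]) (h k).le) (Finset.mem_univ i)
  have h2 := D.integral_service_sq_le t i
  rw [div_le_iff₀ (h i)] at h1
  have h3 : B i = ∫ ω, ((∑ j, D.X 0 ω i j : ℕ) : ℝ) ^ 2 ∂P := rfl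
  linarith

end Downlink

theorem theorem4 {N M : ℕ} [NeZero N] {σ : Type*} [Countable σ] [MeasurableSpace σ]
    [MeasurableSingletonClass σ] {Ω : Type*} [MeasurableSpace Ω] (P : Measure Ω)
    [IsProbabilityMeasure P] (D : Downlink N M σ P) (hirr : D.Irreducible)
    (Λ : Set (Fin N → ℝ)) (hΛ : Λ = D.stabilityRegion ∨ Λ = D.explicitRegion)
    (hint : D.rate ∈ interior Λ) :
    (0 < D.minUserRate ∧ 0 < ∑ j, D.rate j) ∧
    (∃ ρ : ℝ, 0 < ρ ∧ ρ < 1 ∧ D.rate ∈ ρ • Λ) ∧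
    (∃ K : ℝ, ∀ t i, Integrable (fun ω => (D.service t ω i : ℝ) ^ 2) P ∧
      ∫ ω, (D.service t ω i : ℝ) ^ 2 ∂P < K * D.arrivalSq i) ∧
    ∃ Dbar : ℝ≥0,
      (∀ᵐ ω ∂P, Tendsto (fun T => D.averageDelay T ω) atTop (𝓝 (Dbar : ℝ≥0∞))) ∧
      ∀ ρ K : ℝ, 0 < ρ → ρ < 1 → D.rate ∈ ρ • Λ →
        (∀ t i, ∫ ω, (D.service t ω i : ℝ) ^ 2 ∂P ≤ K * D.arrivalSq i) →
        (Dbar : ℝ) ≤ N * (1 + K) * (∑ i, D.arrivalSq i) /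
            (2 * D.minUserRate * (1 - ρ) * ∑ j, D.rate j) ∧
        ∀ b m : ℝ, 0 < m → m ≤ D.minUserRate →
          (∑ i, D.arrivalSq i) ≤ b * ∑ j, D.rate j →
          (Dbar : ℝ) ≤ (1 + K) * b / (2 * m) * (N / (1 - ρ)) := by
  have hsub : Λ ⊆ D.outerRegion := by
    rcases hΛ with rfl | rfl
    exacts [D.stabilityRegion_subset_outerRegion, D.explicitRegion_subset_outerRegion]
  have hrate : ∀ i, 0 < D.rate i := pos_of_mem_interior (fun l hl => (hsub hl).1) hint
  have hsum : 0 < ∑ j, D.rate j := Finset.sum_pos (fun j _ => hrate j) Finset.univ_nonempty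
  have hμ : 0 < D.minUserRate := (Finset.lt_inf'_iff _).2 fun i _ =>
    (hrate i).trans_le (D.rate_le_userRate (hsub (interior_subset hint)) (hrate i))
  have hsq : ∀ i, 0 < D.arrivalSq i := fun i => D.arrivalSq_pos (hrate i)
  obtain ⟨ρ₀, hρ₀0, hρ₀1, hρ₀⟩ := exists_mem_smul_of_mem_interior hint
  have hN : (0 : ℝ) < N := by exact_mod_cast NeZero.pos N
  refine ⟨⟨hμ, hsum⟩, ⟨ρ₀, hρ₀0, hρ₀1, hρ₀⟩, ?_, ?_⟩
  · obtain ⟨K, hK⟩ := D.exists_service_sq_lt hsq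
    exact ⟨K, fun t i => ⟨D.integrable_service_sq t i, hK t i⟩⟩
  obtain ⟨f, s, hf0, -, hf, hs, hdrift⟩ := D.exists_average_limits hirr hμ hρ₀0.le hρ₀1
    (smul_set_mono hsub hρ₀)
  have hDnn : 0 ≤ f / ∑ j, D.rate j := by positivity
  refine ⟨(f / ∑ j, D.rate j).toNNReal, ?_, ?_⟩
  · filter_upwards [hf, ae_all_iff.2 D.ae_tendsto_arrivals] with ω h1 h2
    exact D.tendsto_averageDelay ω hrate h1 h2
  intro ρ K hρ0 hρ1 hρ hK
  rw [Real.coe_toNNReal _ hDnn]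
  set a := ∑ i, D.arrivalSq i with ha
  have ha0 : 0 < a := Finset.sum_pos (fun i _ => hsq i) Finset.univ_nonempty
  have hK0 : 0 ≤ K := by
    have h1 := (integral_nonneg fun ω => sq_nonneg (D.service 0 ω 0 : ℝ)).trans (hK 0 0)
    exact nonneg_of_mul_nonneg_left h1 (hsq 0)
  have hsK : s ≤ K * a := D.average_service_sq_le (by positivity) hs fun t => by
    rw [ha, Finset.mul_sum]
    exact Finset.sum_le_sum fun i _ => hK t i
  have h1ρ : 0 < 1 - ρ := sub_pos.2 hρ1
  have hmain : f * (2 * D.minUserRate * (1 - ρ)) ≤ N * (1 + K) * a := by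
    -- With s ≤ K a this reads 2(1−ρ)(μ/N) f ≤ (1+K) a. Dividing by ∑ λ_j as in Little's law gives
    -- the delay bound.
    have h2 := hdrift ρ hρ0.le hρ1.le (smul_set_mono hsub hρ)
    have h3 : 2 * ((1 - ρ) * D.minUserRate / N * f)
        = f * (2 * D.minUserRate * (1 - ρ)) / N := by ring
    rw [h3, div_le_iff₀ hN] at h2
    nlinarith
  constructor
  · rw [div_le_div_iff₀ hsum (by positivity)]
    calc f * (2 * D.minUserRate * (1 - ρ) * ∑ j, D.rate j)
        = f * (2 * D.minUserRate * (1 - ρ)) * ∑ j, D.rate j := by ring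
      _ ≤ _ := mul_le_mul_of_nonneg_right hmain hsum.le
  · intro b m hm hmμ hb
    have e : (1 + K) * b / (2 * m) * (N / (1 - ρ)) = N * (1 + K) * b / (2 * m * (1 - ρ)) := by
      field_simp
    rw [e, div_le_div_iff₀ hsum (by positivity)]
    calc f * (2 * m * (1 - ρ)) ≤ f * (2 * D.minUserRate * (1 - ρ)) := by gcongr
      _ ≤ N * (1 + K) * a := hmain
      _ ≤ N * (1 + K) * (b * ∑ j, D.rate j) := by gcongr
      _ = _ := by ring

end
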